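/- Let $L\ge 2$ be an integer. Let $\mathbb{H}_L=\bigoplus_{i=1}^\infty \mathbb{Z}/L\mathbb{Z}$ with the distance $\|x-y\|=L^{\max\{i\,:\,x_i\ne y_i\}}$ for $x\neq y$ and $\|x-x\|=0$. Let $E=\{\{x,y\}: x,y\in\mathbb{H}_L,\ x\ne y\}$, and let $|e|=\|x-y\|$ denote the length of $e=\{x,y\}\in E$. Let $J:E\to[0,\infty)$ be isometry-invariant, that is, $J(e)=J(f)$ whenever $|e|=|f|$. Let $\mathbb{P}_J$ be the law of the random graph on $\mathbb{H}_L$ in which each $e\in E$ is open with probability $1-e^{-J(e)}$, independently of all other edges, and let $K_0$ be the connected component (cluster) of the origin in the graph of open edges. Put $$\theta=\mathbb{P}_J\bigl(|K_0|=\infty\bigr),\qquad \beta=\limsup_{|e|\to\infty} J(e)\,\frac{L^{-1}|e|^2}{\log\log|e|}\in[0,\infty].$$ Then either $\theta=0$ or $\beta\,\theta^2\ge 1$ (where $\infty\cdot\theta^2=\infty$ for $\theta>0$). -/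

import Mathlib

open MeasureTheory Filter
open scoped NNReal ENNReal

noncomputable section

/-- The hierarchical lattice of side length `L` (in dimension one): the direct sum of countably
many copies of `ZMod L`. The coordinates are indexed by `i = 0, 1, 2, …`, so that the coordinate
`i` here is the coordinate with number `i + 1` in the usual indexing from `1`. -/
abbrev HierLattice (L : ℕ) : Type := ℕ →₀ ZMod L

/-- The distance of `x` and `y`: it is `0` if `x = y`, and otherwise `L ^ max {i : x_i ≠ y_i}`,
where coordinates are numbered from `1`. -/
def hierDist {L : ℕ} (x y : HierLattice L) : ℝ :=
  if x = y then 0 else (L : ℝ) ^ ((x.neLocus y).sup (fun i => i + 1))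

theorem hierDist_comm {L : ℕ} (x y : HierLattice L) : hierDist x y = hierDist y x := by
  simp only [hierDist, Finsupp.neLocus_comm x y, eq_comm (a := x)]

/-- The potential edges: all unordered pairs of distinct points. -/
abbrev HierEdge (L : ℕ) : Type := {e : Sym2 (HierLattice L) // ¬ e.IsDiag}

/-- The length `|e|` of an edge: the distance of its endpoints. -/
def HierEdge.length {L : ℕ} (e : HierEdge L) : ℝ :=
  Sym2.lift ⟨hierDist, hierDist_comm⟩ e.1

/-- A kernel `J : E → [0, ∞)` is isometry-invariant if edges of equal length have equal weight. -/
def IsIsometryInvariant {L : ℕ} (J : HierEdge L → ℝ≥0) : Prop :=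
  ∀ e f : HierEdge L, e.length = f.length → J e = J f

/-- The probability `1 - exp (-J e)` that the edge `e` is open. -/
def openProb {L : ℕ} (J : HierEdge L → ℝ≥0) (e : HierEdge L) : unitInterval :=
  ⟨1 - Real.exp (-(J e : ℝ)), by
    constructor
    · have : Real.exp (-(J e : ℝ)) ≤ 1 := Real.exp_le_one_iff.2 (by simp)
      linarith
    · have := Real.exp_pos (-(J e : ℝ))
      linarith⟩

/-- The percolation measure `P_J` on configurations `ω` of open (`true`) and closed (`false`)
edges: the edges are independent and `e` is open with probability `1 - exp (-J e)`. -/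
def percMeasure {L : ℕ} (J : HierEdge L → ℝ≥0) : Measure (HierEdge L → Bool) :=
  Measure.infinitePi fun e => ProbabilityTheory.bernoulliMeasure true false (openProb J e)

instance {L : ℕ} (J : HierEdge L → ℝ≥0) : IsProbabilityMeasure (percMeasure J) := by
  unfold percMeasure
  infer_instance

/-- The random graph of the open edges of a configuration. -/
def openGraph {L : ℕ} (ω : HierEdge L → Bool) : SimpleGraph (HierLattice L) where
  Adj x y := ∃ h : ¬ (s(x, y)).IsDiag, ω ⟨s(x, y), h⟩ = true
  symm := ⟨fun x y ⟨h, hω⟩ => by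
    have hs : s(y, x) = s(x, y) := Sym2.eq_swap
    simp only [hs]
    exact ⟨h, hω⟩⟩
  loopless := ⟨fun x ⟨h, _⟩ => h (by simp)⟩

/-- The open cluster `K_x`: all points that are joined to `x` by a path of open edges. -/
def openCluster {L : ℕ} (ω : HierEdge L → Bool) (x : HierLattice L) : Set (HierLattice L) :=
  {y | (openGraph ω).Reachable x y}

/-- The density `θ = P_J (|K_0| = ∞)`. -/
def clusterDensity {L : ℕ} (J : HierEdge L → ℝ≥0) : ℝ :=
  (percMeasure J).real {ω | (openCluster ω 0).Infinite}

/-- The extended real number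
`β = limsup J(e) L⁻¹ |e|² / log log |e|` as the length `|e|` of the edge tends to infinity. -/
def kernelLimsup {L : ℕ} (J : HierEdge L → ℝ≥0) : EReal :=
  limsup
    (fun e : HierEdge L =>
      (((J e : ℝ) * ((L : ℝ)⁻¹ * e.length ^ 2 / Real.log (Real.log e.length)) : ℝ) : EReal))
    (comap HierEdge.length atTop)

end

/-! Suppose $\beta<b$ and $b\,\theta^2<1$; the claim is that the cluster of the origin is almost
surely finite. Write $B_n$ for the ball of level $n$ and $W_n=L^n\cdot$`tailWeight J n` for the
total weight of the edges leaving it. Summing the kernel over the spheres gives $W_n\le b\log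
n+O(1)$ (`exists_tailWeight_le`).

Choose levels $n_j$ with $n_{j+1}-n_j\asymp\log j$, so that $n_j=O(j\log j)$, and let
$A_j=B_{n_{j+1}}\setminus B_{n_j}$. Fix $M$ and call the cluster of a point inside one annulus large
if it has at least $M$ points. By the first Borel-Cantelli lemma two things hold almost surely for
all large $j$: no open edge jumps from $B_{n_j}$ over $A_j$ (`percMeasure_skip_le`), and a small
cluster of $A_j$ does not have open edges to two different points outside $A_j$
(`percMeasure_not_deadEnd_hierAnnulus_le`). A self-avoiding open path that goes far out must then
leave $B_{n_{j+1}}$ along an edge joining a large cluster of $A_j$ to a large cluster of $A_{j+1}$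
(`largeClustersJoined_of_reachable`).

Let $\theta_M$ be the probability that the origin has a cluster of at least $M$ points. Given the
large clusters of both annuli, the edges between them are still independent; Jensen's inequality
bounds the probability that no such edge is open below by $\exp(-\theta_M^2(b\log n_{j+1}+C))$
(`exp_neg_le_measureReal_not_largeClustersJoined`). The square is the chance that both endpoints lie
in large clusters. As $\theta_M\to\theta$, some $M$ has $b\,\theta_M^2<1$; this slack absorbs the
$\log\log j$ in $\log n_j$, and the bound is at least a constant times $1/j$. Disjoint pairs of
annuli give independent events, so by the second Borel-Cantelli lemma infinitely many pairs fail to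
be joined. Hence the cluster is finite. -/

section ProductMeasure

/-! ### Events that depend on finitely many coordinates of a product measure -/

variable {ι : Type*} (μ : ι → Measure Bool) [∀ i, IsProbabilityMeasure (μ i)]

theorem DependsOn.mem_iff {A : Set (ι → Bool)} {S : Set ι} (h : DependsOn (· ∈ A) S)
    {x y : ι → Bool} (hxy : ∀ i ∈ S, x i = y i) : x ∈ A ↔ y ∈ A :=
  iff_of_eq (h hxy)

theorem DependsOn.eq_preimage_restrict {A : Set (ι → Bool)} {S : Finset ι}
    (h : DependsOn (· ∈ A) (S : Set ι)) :
    A = (fun (ω : ι → Bool) (i : S) => ω i) ⁻¹' ((fun (ω : ι → Bool) (i : S) => ω i) '' A) := by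
  ext ω
  constructor
  · intro hω
    exact ⟨ω, hω, rfl⟩
  · rintro ⟨ω', hω', heq⟩
    exact (h.mem_iff fun i hi => congrFun heq ⟨i, hi⟩).1 hω'

theorem DependsOn.measurableSet {A : Set (ι → Bool)} {S : Finset ι}
    (h : DependsOn (· ∈ A) (S : Set ι)) : MeasurableSet A := by
  rw [h.eq_preimage_restrict]
  exact (measurable_pi_lambda _ fun i => measurable_pi_apply _) (Set.toFinite _).measurableSet

/-- Events that depend on disjoint finite sets of coordinates are independent. -/
theorem infinitePi_inter_of_dependsOn {A B : Set (ι → Bool)} {S T : Finset ι}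
    (hA : DependsOn (· ∈ A) (S : Set ι)) (hB : DependsOn (· ∈ B) (T : Set ι))
    (hST : Disjoint S T) :
    Measure.infinitePi μ (A ∩ B) = Measure.infinitePi μ A * Measure.infinitePi μ B := by
  have hind : ProbabilityTheory.iIndepFun (fun (i : ι) (ω : ι → Bool) => ω i)
      (Measure.infinitePi μ) :=
    ProbabilityTheory.iIndepFun_infinitePi (P := μ) (X := fun _ x => x) (fun _ => measurable_id)
  have h := hind.indepFun_finset S T hST (fun i => measurable_pi_apply i)
  have h2 := h.measure_inter_preimage_eq_mul
    ((fun (ω : ι → Bool) (i : S) => ω i) '' A) ((fun (ω : ι → Bool) (i : T) => ω i) '' B)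
    (Set.toFinite _).measurableSet (Set.toFinite _).measurableSet
  rwa [← hA.eq_preimage_restrict, ← hB.eq_preimage_restrict] at h2

theorem DependsOn.mono_set {A : Set (ι → Bool)} {S T : Set ι} (h : DependsOn (· ∈ A) S)
    (hST : S ⊆ T) : DependsOn (· ∈ A) T :=
  fun _ _ hxy => h fun i hi => hxy i (hST hi)

theorem dependsOn_inter {A B : Set (ι → Bool)} {S T : Set ι} (hA : DependsOn (· ∈ A) S)
    (hB : DependsOn (· ∈ B) T) : DependsOn (· ∈ A ∩ B) (S ∪ T) := fun x y hxy => by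
  have h1 := hA.mem_iff fun i hi => hxy i (Or.inl hi)
  have h2 := hB.mem_iff fun i hi => hxy i (Or.inr hi)
  simp only [Set.mem_inter_iff, h1, h2]

/-- Induction on the finite index set; the dependence of the intersection on the union of the
coordinate sets has to be carried along, since it is what allows the next event to be split off. -/
theorem iIndepSet_of_dependsOn {A : ℕ → Set (ι → Bool)} {S : ℕ → Finset ι}
    (hA : ∀ n, DependsOn (· ∈ A n) (S n : Set ι)) (hS : Pairwise fun m n => Disjoint (S m) (S n)) :
    ProbabilityTheory.iIndepSet A (Measure.infinitePi μ) := by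
  classical
  rw [ProbabilityTheory.iIndepSet_iff_meas_biInter fun n => (hA n).measurableSet]
  intro s
  have key : DependsOn (· ∈ ⋂ i ∈ s, A i) (s.biUnion S : Set ι) ∧
      Measure.infinitePi μ (⋂ i ∈ s, A i) = ∏ i ∈ s, Measure.infinitePi μ (A i) := by
    induction s using Finset.induction_on with
    | empty => exact ⟨fun x y _ => by simp, by simp⟩
    | insert a s ha ih =>
      rw [Finset.set_biInter_insert, Finset.prod_insert ha, Finset.biUnion_insert, Finset.coe_union]
      refine ⟨dependsOn_inter (hA a) ih.1, ?_⟩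
      rw [infinitePi_inter_of_dependsOn μ (hA a) ih.1, ih.2]
      rw [Finset.disjoint_biUnion_right]
      intro i hi
      exact hS (by rintro rfl; exact ha hi)
  exact key.2

end ProductMeasure

/-! ### Deterministic part: a long path joins large local clusters -/

section Graph

variable {V : Type*}

/-- The spanning subgraph of the edges with both endpoints in `R`. -/
def SimpleGraph.within (G : SimpleGraph V) (R : Set V) : SimpleGraph V where
  Adj x y := G.Adj x y ∧ x ∈ R ∧ y ∈ R
  symm := ⟨fun _ _ h => ⟨h.1.symm, h.2.2, h.2.1⟩⟩
  loopless := ⟨fun x h => G.loopless.irrefl x h.1⟩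

/-- The cluster of `x` formed by the edges inside `R`. -/
def localCluster (G : SimpleGraph V) (R : Set V) (x : V) : Set V :=
  {y | (G.within R).Reachable x y}

theorem localCluster_subset {G : SimpleGraph V} {R : Set V} {x : V} (hx : x ∈ R) :
    localCluster G R x ⊆ R := by
  rintro y ⟨p⟩
  induction p with
  | nil => exact hx
  | cons h p ih => exact ih h.2.2

theorem localCluster_subset_cluster (G : SimpleGraph V) (R : Set V) (x : V) :
    localCluster G R x ⊆ {y | G.Reachable x y} :=
  fun _ hy => SimpleGraph.Reachable.mono (show G.within R ≤ G from fun _ _ h => h.1) hy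

theorem SimpleGraph.Walk.reachable_within {G : SimpleGraph V} {R : Set V} {o v : V}
    (p : G.Walk o v) {s t : ℕ} (hst : s ≤ t) (ht : t ≤ p.length)
    (hR : ∀ k, s ≤ k → k ≤ t → p.getVert k ∈ R) :
    (G.within R).Reachable (p.getVert s) (p.getVert t) := by
  induction t, hst using Nat.le_induction with
  | base => exact SimpleGraph.Reachable.refl _
  | succ t hst ih =>
    refine (ih (by omega) fun k h1 h2 => hR k h1 (by omega)).trans ?_
    refine SimpleGraph.Adj.reachable ⟨p.adj_getVert_succ (by omega), hR t hst (by omega),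
      hR (t + 1) (by omega) le_rfl⟩

/-- Every small local cluster in `R` is a dead end: all its edges to the complement of `R` have
the same outer endpoint. -/
def SmallClustersDeadEnd (G : SimpleGraph V) (R : Set V) (M : ℕ) : Prop :=
  ∀ w ∈ R, ∀ w' ∈ localCluster G R w, ∀ u ∉ R, ∀ u' ∉ R, u ≠ u' → G.Adj w u → G.Adj w' u' →
    (M : ℕ∞) ≤ (localCluster G R w).encard

/-- There is an edge between large local clusters of `R` and `R'`. -/
def LargeClustersJoined (G : SimpleGraph V) (R R' : Set V) (M : ℕ) : Prop :=
  ∃ x ∈ R, ∃ y ∈ R', G.Adj x y ∧ (M : ℕ∞) ≤ (localCluster G R x).encard ∧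
    (M : ℕ∞) ≤ (localCluster G R' y).encard

/-- Follow a self-avoiding path to its first exit from `B`. Since no edge skips an annulus, the exit
edge runs from `B \ A` to `C \ B`. The stretch of the path before it, back to the last visit to `A`,
lies in one local cluster of `B \ A`, and this cluster is attached both to that visit and to the
exit point. The stretch after it, up to the first departure from `C \ B`, is treated in the same
way. The two outer points are distinct because the path is self-avoiding, so neither cluster is a
dead end. -/
theorem largeClustersJoined_of_reachable {G : SimpleGraph V} {A B C : Set V} {M : ℕ}
    (hAB : A ⊆ B) (hBC : B ⊆ C) {o v : V} (ho : o ∈ A) (hv : v ∉ C) (hov : G.Reachable o v)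
    (hskip : ∀ x ∈ A, ∀ y ∉ B, ¬ G.Adj x y) (hskip' : ∀ x ∈ B, ∀ y ∉ C, ¬ G.Adj x y)
    (hdead : SmallClustersDeadEnd G (B \ A) M) (hdead' : SmallClustersDeadEnd G (C \ B) M) :
    LargeClustersJoined G (B \ A) (C \ B) M := by
  classical
  obtain ⟨p, hp⟩ := hov.exists_isPath
  have hinj : ∀ {i j : ℕ}, i ≤ p.length → j ≤ p.length → i ≠ j → p.getVert i ≠ p.getVert j :=
    fun hi hj hij h => hij (hp.getVert_injOn hi hj h)
  have hex : ∃ i, p.getVert i ∉ B := ⟨p.length, by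
    rw [SimpleGraph.Walk.getVert_length]; exact fun h => hv (hBC h)⟩
  obtain ⟨i, hiB, hmin⟩ : ∃ i, p.getVert i ∉ B ∧ ∀ k < i, p.getVert k ∈ B :=
    ⟨Nat.find hex, Nat.find_spec hex, fun k hk => not_not.1 (Nat.find_min hex hk)⟩
  have hi0 : i ≠ 0 := by
    rintro rfl
    rw [SimpleGraph.Walk.getVert_zero] at hiB
    exact hiB (hAB ho)
  obtain ⟨n, rfl⟩ := Nat.exists_eq_succ_of_ne_zero hi0
  have hn : n + 1 ≤ p.length := by
    by_contra h
    have h1 := hmin p.length (by omega)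
    rw [SimpleGraph.Walk.getVert_length] at h1
    exact hv (hBC h1)
  have hadj := p.adj_getVert_succ (i := n) (by omega)
  have hxB := hmin n (by omega)
  have hxA : p.getVert n ∉ A := fun h => hskip _ h _ hiB hadj
  have hyC : p.getVert (n + 1) ∈ C := by
    by_contra h
    exact hskip' _ hxB _ h hadj
  refine ⟨_, ⟨hxB, hxA⟩, _, ⟨hyC, hiB⟩, hadj, ?_, ?_⟩
  · obtain ⟨a, haA, han, hmax⟩ : ∃ a, p.getVert a ∈ A ∧ a ≤ n ∧
        ∀ k, a < k → k ≤ n → p.getVert k ∉ A := by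
      have h0 : p.getVert 0 ∈ A := by rwa [SimpleGraph.Walk.getVert_zero]
      refine ⟨Nat.findGreatest (fun k => p.getVert k ∈ A) n,
        Nat.findGreatest_spec (P := fun k => p.getVert k ∈ A) (Nat.zero_le n) h0,
        Nat.findGreatest_le n, fun k hk hkn => Nat.findGreatest_is_greatest hk hkn⟩
    have han' : a < n := lt_of_le_of_ne han (by rintro rfl; exact hxA haA)
    refine hdead (p.getVert n) ⟨hxB, hxA⟩ (p.getVert (a + 1)) ?_ (p.getVert (n + 1))
      (fun h => hiB h.1) (p.getVert a)
      (fun h => h.2 haA) (hinj (by omega) (by omega) (by omega)) hadj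
      (p.adj_getVert_succ (by omega)).symm
    exact (p.reachable_within (R := B \ A) (by omega) (by omega) fun k h1 h2 =>
      ⟨hmin k (by omega), hmax k (by omega) h2⟩).symm
  · have hex' : ∃ b, n + 1 ≤ b ∧ p.getVert b ∉ C \ B := ⟨p.length, hn, by
      rw [SimpleGraph.Walk.getVert_length]; exact fun h => hv h.1⟩
    obtain ⟨b, ⟨hnb, hbC⟩, hbmin⟩ : ∃ b, (n + 1 ≤ b ∧ p.getVert b ∉ C \ B) ∧
        ∀ k < b, ¬ (n + 1 ≤ k ∧ p.getVert k ∉ C \ B) :=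
      ⟨Nat.find hex', Nat.find_spec hex', fun k hk => Nat.find_min hex' hk⟩
    have hb : b ≤ p.length := by
      by_contra h
      refine hbmin p.length (by omega) ⟨hn, ?_⟩
      rw [SimpleGraph.Walk.getVert_length]
      exact fun h => hv h.1
    have hnb' : n + 1 ≠ b := by
      rintro rfl
      exact hbC ⟨hyC, hiB⟩
    obtain ⟨c, rfl⟩ := Nat.exists_eq_succ_of_ne_zero (show b ≠ 0 by omega)
    refine hdead' (p.getVert (n + 1)) ⟨hyC, hiB⟩ (p.getVert c) ?_ (p.getVert n) (fun h => h.2 hxB)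
      (p.getVert (c + 1)) hbC (hinj (by omega) (by omega) (by omega)) hadj.symm
      (p.adj_getVert_succ (by omega))
    exact p.reachable_within (by omega) (by omega) fun k h1 h2 => by
      by_contra h
      exact hbmin k (by omega) ⟨h1, h⟩

end Graph

/-! ### Levels and balls of the hierarchical lattice -/

section Lattice

variable {L : ℕ}

/-- The least `n` such that `x` and `y` lie in a common ball of level `n`. -/
def hierLevel (x y : HierLattice L) : ℕ := (x.neLocus y).sup (fun i => i + 1)

theorem hierLevel_le_iff {x y : HierLattice L} {n : ℕ} :
    hierLevel x y ≤ n ↔ ∀ i, n ≤ i → x i = y i := by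
  simp only [hierLevel, Finset.sup_le_iff, Finsupp.mem_neLocus]
  constructor
  · intro h i hi
    by_contra hne
    have := h i hne
    omega
  · intro h i hne
    by_contra hi
    exact hne (h i (by omega))

theorem hierLevel_comm (x y : HierLattice L) : hierLevel x y = hierLevel y x := by
  simp only [hierLevel, Finsupp.neLocus_comm x y]

theorem hierLevel_zero_sub (x y : HierLattice L) : hierLevel 0 (y - x) = hierLevel x y := by
  refine eq_of_forall_ge_iff fun n => ?_
  simp only [hierLevel_le_iff, Finsupp.coe_zero, Pi.zero_apply, Finsupp.coe_sub, Pi.sub_apply]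
  refine forall₂_congr fun i _ => ?_
  rw [eq_comm, sub_eq_zero, eq_comm]

theorem hierLevel_add_right (x y z : HierLattice L) :
    hierLevel (x + z) (y + z) = hierLevel x y := by
  rw [← hierLevel_zero_sub, ← hierLevel_zero_sub x, add_sub_add_right_eq_sub]

theorem hierLevel_pos {x y : HierLattice L} (h : x ≠ y) : 0 < hierLevel x y := by
  by_contra h0
  refine h (Finsupp.ext fun i => hierLevel_le_iff.1 (Nat.le_zero.2 (by omega)) i (Nat.zero_le i))

theorem hierLevel_zero_single [Nontrivial (ZMod L)] (n : ℕ) :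
    hierLevel (0 : HierLattice L) (Finsupp.single n 1) = n + 1 := by
  refine eq_of_forall_ge_iff fun m => ?_
  rw [hierLevel_le_iff]
  constructor
  · intro h
    by_contra hm
    have := h n (by omega)
    simp at this
  · intro h i hi
    rw [Finsupp.single_eq_of_ne (by omega)]
    rfl

theorem hierDist_of_ne {x y : HierLattice L} (h : x ≠ y) :
    hierDist x y = (L : ℝ) ^ hierLevel x y := by
  rw [hierDist, if_neg h, hierLevel]

variable (L) in
/-- The ball of level `n` around the origin. -/
noncomputable def hierBall [NeZero L] (n : ℕ) : Finset (HierLattice L) :=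
  (Finset.range n).finsupp fun _ => Finset.univ

theorem mem_hierBall [NeZero L] {n : ℕ} {x : HierLattice L} :
    x ∈ hierBall L n ↔ ∀ i, n ≤ i → x i = 0 := by
  rw [hierBall, Finset.mem_finsupp_iff]
  simp only [Finset.mem_univ, implies_true, and_true]
  constructor
  · intro h i hi
    by_contra h0
    have := Finset.mem_range.1 (h (Finsupp.mem_support_iff.2 h0))
    omega
  · intro h i hi
    by_contra h0
    exact Finsupp.mem_support_iff.1 hi (h i (by simpa using h0))

theorem mem_hierBall_iff_level [NeZero L] {n : ℕ} {x : HierLattice L} :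
    x ∈ hierBall L n ↔ hierLevel 0 x ≤ n := by
  rw [mem_hierBall, hierLevel_le_iff]
  simp [eq_comm]

theorem zero_mem_hierBall [NeZero L] (n : ℕ) : (0 : HierLattice L) ∈ hierBall L n :=
  mem_hierBall.2 fun _ _ => rfl

theorem hierBall_mono [NeZero L] {m n : ℕ} (h : m ≤ n) : hierBall L m ⊆ hierBall L n :=
  fun _ hx => mem_hierBall.2 fun i hi => mem_hierBall.1 hx i (h.trans hi)

theorem card_hierBall [NeZero L] (n : ℕ) : (hierBall L n).card = L ^ n := by
  rw [hierBall, Finset.card_finsupp]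
  simp [ZMod.card]

theorem lt_hierLevel [NeZero L] {n : ℕ} {x y : HierLattice L} (hx : x ∈ hierBall L n)
    (hy : y ∉ hierBall L n) : n < hierLevel x y := by
  by_contra h
  refine hy (mem_hierBall.2 fun i hi => ?_)
  rw [← hierLevel_le_iff.1 (not_lt.1 h) i hi, mem_hierBall.1 hx i hi]

end Lattice

/-! ### The kernel as a function of the level, and the boundary weight of balls -/

section Weight

variable {L : ℕ}

open scoped Classical in
/-- The weight of the pair `x`, `y`, which is zero on the diagonal. -/
noncomputable def pairWeight (J : HierEdge L → ℝ≥0) (x y : HierLattice L) : ℝ≥0 :=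
  if h : ¬ (s(x, y)).IsDiag then J ⟨s(x, y), h⟩ else 0

theorem HierEdge.length_mk {x y : HierLattice L} (h : ¬ (s(x, y)).IsDiag) :
    HierEdge.length ⟨s(x, y), h⟩ = (L : ℝ) ^ hierLevel x y :=
  hierDist_of_ne (by simpa using h)

theorem pairWeight_comm (J : HierEdge L → ℝ≥0) (x y : HierLattice L) :
    pairWeight J x y = pairWeight J y x := by
  simp only [pairWeight, Sym2.eq_swap (a := x)]

/-- The weight of the edges of length `L ^ n`. -/
noncomputable def levelWeight (J : HierEdge L → ℝ≥0) (n : ℕ) : ℝ≥0 :=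
  pairWeight J 0 (Finsupp.single (n - 1) 1)

variable {J : HierEdge L → ℝ≥0}

theorem IsIsometryInvariant.pairWeight_eq (hJ : IsIsometryInvariant J) {x y x' y' : HierLattice L}
    (h : x ≠ y) (h' : x' ≠ y') (hl : hierLevel x y = hierLevel x' y') :
    pairWeight J x y = pairWeight J x' y' := by
  rw [pairWeight, pairWeight, dif_pos (by simpa using h), dif_pos (by simpa using h')]
  apply hJ
  rw [HierEdge.length_mk, HierEdge.length_mk, hl]

theorem IsIsometryInvariant.pairWeight_eq_levelWeight [Nontrivial (ZMod L)]
    (hJ : IsIsometryInvariant J) {x y : HierLattice L} (h : x ≠ y) :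
    pairWeight J x y = levelWeight J (hierLevel x y) := by
  refine hJ.pairWeight_eq h (by simp [eq_comm]) ?_
  rw [hierLevel_zero_single]
  -- Distinct points have positive level, so the truncated `n - 1` in `levelWeight` does no harm.
  have := hierLevel_pos h
  omega

variable (J) in
/-- The total weight of the edges at the origin of length more than `L ^ n`. -/
noncomputable def tailWeight (n : ℕ) : ℝ≥0∞ :=
  ∑' z : HierLattice L, if n < hierLevel 0 z then (pairWeight J 0 z : ℝ≥0∞) else 0

theorem IsIsometryInvariant.tsum_pairWeight (hJ : IsIsometryInvariant J) (x : HierLattice L)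
    (n : ℕ) :
    ∑' y : HierLattice L, (if n < hierLevel x y then (pairWeight J x y : ℝ≥0∞) else 0) =
      tailWeight J n := by
  rw [tailWeight]
  refine Eq.trans ?_ ((Equiv.subRight x).tsum_eq _)
  refine tsum_congr fun y => ?_
  rw [Equiv.subRight_apply, hierLevel_zero_sub]
  by_cases h : n < hierLevel x y
  · have hxy : x ≠ y := by
      rintro rfl
      have : hierLevel x x ≤ n := hierLevel_le_iff.2 fun _ _ => rfl
      omega
    rw [if_pos h, if_pos h, hJ.pairWeight_eq hxy (sub_ne_zero.2 hxy.symm).symm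
      (hierLevel_zero_sub x y).symm]
  · rw [if_neg h, if_neg h]

/-- A vertex has weight at most `tailWeight J n` to any set of vertices at level above `n`. -/
theorem IsIsometryInvariant.tsum_pairWeight_le (hJ : IsIsometryInvariant J) {x : HierLattice L}
    {n : ℕ} {p : HierLattice L → Prop} [DecidablePred p] (hp : ∀ y, p y → n < hierLevel x y) :
    ∑' y : HierLattice L, (if p y then (pairWeight J x y : ℝ≥0∞) else 0) ≤ tailWeight J n := by
  rw [← hJ.tsum_pairWeight x n]
  refine ENNReal.tsum_le_tsum fun y => ?_
  by_cases h : p y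
  · rw [if_pos h, if_pos (hp y h)]
  · rw [if_neg h]
    exact zero_le

theorem IsIsometryInvariant.tailWeight_eq [NeZero L] [Nontrivial (ZMod L)]
    (hJ : IsIsometryInvariant J) (n : ℕ) :
    tailWeight J n =
      ∑' j : ℕ, ((L ^ (n + j + 1) - L ^ (n + j) : ℕ) : ℝ≥0∞) * levelWeight J (n + j + 1) := by
  have h1 : ∀ z : HierLattice L, (if n < hierLevel 0 z then (pairWeight J 0 z : ℝ≥0∞) else 0) =
      ∑' j : ℕ, if hierLevel 0 z = n + j + 1 then (levelWeight J (n + j + 1) : ℝ≥0∞) else 0 := by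
    intro z
    by_cases h : n < hierLevel 0 z
    · have hz : (0 : HierLattice L) ≠ z := by
        rintro rfl
        have : hierLevel (0 : HierLattice L) 0 ≤ n := hierLevel_le_iff.2 fun _ _ => rfl
        omega
      rw [if_pos h, tsum_eq_single (hierLevel 0 z - n - 1) fun j hj => if_neg (by omega)]
      have he : n + (hierLevel 0 z - n - 1) + 1 = hierLevel 0 z := by omega
      rw [he, if_pos rfl, hJ.pairWeight_eq_levelWeight hz]
    · rw [if_neg h, eq_comm, ENNReal.tsum_eq_zero]
      exact fun j => if_neg (by omega)
  rw [tailWeight, tsum_congr h1, ENNReal.tsum_comm]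
  refine tsum_congr fun j => ?_
  have hmem : ∀ z : HierLattice L, z ∈ hierBall L (n + j + 1) \ hierBall L (n + j) ↔
      hierLevel 0 z = n + j + 1 := by
    intro z
    rw [Finset.mem_sdiff, mem_hierBall_iff_level, mem_hierBall_iff_level]
    omega
  rw [tsum_eq_sum (s := hierBall L (n + j + 1) \ hierBall L (n + j))
    fun z hz => if_neg fun h => hz ((hmem z).2 h),
    Finset.sum_congr rfl fun z hz => if_pos ((hmem z).1 hz), Finset.sum_const,
    Finset.card_sdiff_of_subset (hierBall_mono (by omega)), card_hierBall, card_hierBall,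
    nsmul_eq_mul]

theorem levelWeight_le_of_kernelLimsup_lt (hL : 2 ≤ L) {b : ℝ}
    (hb : kernelLimsup J < (b : EReal)) :
    ∃ n₀ : ℕ, ∀ m, n₀ ≤ m →
      (levelWeight J (m + 1) : ℝ) ≤
        b * ((L : ℝ)⁻¹ * ((L : ℝ) ^ (2 * m))⁻¹ * Real.log ((m + 1) * Real.log L)) := by
  have : Fact (1 < L) := ⟨by omega⟩
  have hev := eventually_lt_of_limsup_lt hb
  rw [eventually_comap, eventually_atTop] at hev
  obtain ⟨r, hr⟩ := hev
  have hL1 : (1 : ℝ) < L := by exact_mod_cast this.out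
  obtain ⟨N, hN⟩ := pow_unbounded_of_one_lt r hL1
  -- The summand 2 gives `m ≥ 2`, so that `(m + 1) * log L > 1` and the double logarithm is
  -- positive.
  refine ⟨N + 2, fun m hm => ?_⟩
  have hne : ¬ (s((0 : HierLattice L), Finsupp.single m 1)).IsDiag := by simp [eq_comm]
  have hlen : HierEdge.length ⟨s((0 : HierLattice L), Finsupp.single m 1), hne⟩ =
      (L : ℝ) ^ (m + 1) := by
    rw [HierEdge.length_mk, hierLevel_zero_single]
  have h := hr ((L : ℝ) ^ (m + 1))
    (hN.le.trans (pow_le_pow_right₀ hL1.le (by omega))) _ hlen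
  rw [EReal.coe_lt_coe_iff, hlen, Real.log_pow] at h
  have hw : J ⟨s((0 : HierLattice L), Finsupp.single m 1), hne⟩ = levelWeight J (m + 1) := by
    rw [levelWeight, pairWeight, dif_pos (by simpa using hne)]
    rfl
  rw [hw] at h
  have hlogL : 1 / 2 < Real.log L := by
    have h2 : Real.log 2 ≤ Real.log L := Real.log_le_log (by norm_num) (by exact_mod_cast hL)
    have := Real.log_two_gt_d9
    linarith
  have hlog : 0 < Real.log ((m + 1) * Real.log L) := by
    apply Real.log_pos
    have : (2 : ℝ) ≤ m := by exact_mod_cast (show 2 ≤ m by omega)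
    nlinarith
  push_cast at h
  have hLpos : (0 : ℝ) < L := by linarith
  have hc : 0 < (L : ℝ)⁻¹ * ((L : ℝ) ^ (m + 1)) ^ 2 / Real.log ((m + 1) * Real.log L) := by
    positivity
  rw [← lt_div_iff₀ hc] at h
  refine h.le.trans (le_of_eq ?_)
  field_simp
  ring

/-- If `kernelLimsup J < b`, then the total weight of the boundary edges of a ball of level `n`
is at most `b * log n + O(1)`. -/
theorem IsIsometryInvariant.exists_tailWeight_le [NeZero L] (hJ : IsIsometryInvariant J)
    (hL : 2 ≤ L) {b : ℝ} (hb0 : 0 ≤ b) (hb : kernelLimsup J < (b : EReal)) :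
    ∃ C : ℝ, 0 ≤ C ∧ ∃ n₀ : ℕ, ∀ n, n₀ ≤ n → 1 ≤ n →
      (L : ℝ≥0∞) ^ n * tailWeight J n ≤ ENNReal.ofReal (b * Real.log n + C) := by
  have : Fact (1 < L) := ⟨by omega⟩
  obtain ⟨n₀, hn₀⟩ := levelWeight_le_of_kernelLimsup_lt hL hb
  have hL2 : (2 : ℝ) ≤ L := by exact_mod_cast hL
  have hLpos : (0 : ℝ) < L := by linarith
  -- After the powers of `L` cancel, the sphere of level `n + j + 1` contributes at most `b * g j`
  -- times a double logarithm. The weights `g` sum to 1, which is why the constant in front of `log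
  -- n` is exactly `b`.
  set g : ℕ → ℝ := fun j => (1 - (L : ℝ)⁻¹) * (L : ℝ)⁻¹ ^ j with hg
  have hinv : (L : ℝ)⁻¹ < 1 := inv_lt_one_of_one_lt₀ (by linarith)
  have hinv0 : 0 ≤ (L : ℝ)⁻¹ := by positivity
  have hg0 : ∀ j, 0 ≤ g j := fun j => mul_nonneg (by linarith) (by positivity)
  have hgsum : HasSum g 1 := by
    have := (hasSum_geometric_of_lt_one hinv0 hinv).mul_left (1 - (L : ℝ)⁻¹)
    rwa [mul_inv_cancel₀ (by linarith)] at this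
  have hgs : Summable fun j => g j * (j + 1 + L) := by
    have h1 : Summable fun j : ℕ => (j : ℝ) ^ 1 * (L : ℝ)⁻¹ ^ j :=
      summable_pow_mul_geometric_of_norm_lt_one 1 (by
        rw [Real.norm_of_nonneg hinv0]; exact hinv)
    have h2 := (h1.mul_left (1 - (L : ℝ)⁻¹)).add (hgsum.summable.mul_right ((1 : ℝ) + L))
    refine h2.congr fun j => ?_
    simp only [hg]
    ring
  refine ⟨b * ∑' j, g j * (j + 1 + L), mul_nonneg hb0 (tsum_nonneg fun j =>
    mul_nonneg (hg0 j) (by positivity)), n₀, fun n hn hn1 => ?_⟩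
  have hn1' : (1 : ℝ) ≤ n := by exact_mod_cast hn1
  have hsum : HasSum (fun j : ℕ => b * (g j * (Real.log n + (j + 1 + L))))
      (b * Real.log n + b * ∑' j, g j * (j + 1 + L)) := by
    have := ((hgsum.mul_right (Real.log n)).add hgs.hasSum).mul_left b
    rw [one_mul, mul_add] at this
    refine this.congr_fun ?_
    intro j
    ring
  have hnonneg : ∀ j : ℕ, 0 ≤ b * (g j * (Real.log n + (j + 1 + L))) := fun j =>
    mul_nonneg hb0 (mul_nonneg (hg0 j) (add_nonneg (Real.log_nonneg hn1') (by positivity)))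
  rw [← hsum.tsum_eq, ENNReal.ofReal_tsum_of_nonneg hnonneg hsum.summable, hJ.tailWeight_eq,
    ← ENNReal.tsum_mul_left]
  refine ENNReal.tsum_le_tsum fun j => ?_
  -- Since `n + j + 1 ≤ n * (j + 2)`, the dependence on `n` is only `log n`; the remainder is linear
  -- in `j` and summable against `g`.
  have hlog : Real.log ((((n + j : ℕ) : ℝ) + 1) * Real.log L) ≤ Real.log n + (j + 1 + L) := by
    have hlogL : 0 < Real.log L := Real.log_pos (by linarith)
    have h1 : (((n + j : ℕ) : ℝ) + 1) * Real.log L ≤ n * ((j + 2) * Real.log L) := by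
      push_cast
      have : (n : ℝ) + j + 1 ≤ n * (j + 2) := by
        nlinarith [(Nat.cast_nonneg j : (0 : ℝ) ≤ j)]
      nlinarith
    have h2 := Real.log_le_log (by positivity) h1
    rw [Real.log_mul (x := (n : ℝ)) (by positivity) (by positivity),
      Real.log_mul (x := (j : ℝ) + 2) (by positivity) hlogL.ne'] at h2
    have h3 := Real.log_le_sub_one_of_pos (show (0 : ℝ) < j + 2 by positivity)
    have h4 := Real.log_le_sub_one_of_pos hlogL
    have h5 := Real.log_le_sub_one_of_pos hLpos
    linarith
  have hw := hn₀ (n + j) (by omega)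
  have hcast : ((L ^ (n + j + 1) - L ^ (n + j) : ℕ) : ℝ) =
      (L : ℝ) ^ (n + j + 1) - (L : ℝ) ^ (n + j) := by
    rw [Nat.cast_sub (Nat.pow_le_pow_right (by omega) (by omega))]
    push_cast
    rfl
  have hlhs : (L : ℝ≥0∞) ^ n *
      (((L ^ (n + j + 1) - L ^ (n + j) : ℕ) : ℝ≥0∞) * levelWeight J (n + j + 1)) =
      ENNReal.ofReal ((L : ℝ) ^ n * (((L ^ (n + j + 1) - L ^ (n + j) : ℕ) : ℝ) *
        (levelWeight J (n + j + 1) : ℝ))) := by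
    rw [ENNReal.ofReal_mul (by positivity), ENNReal.ofReal_mul (by positivity),
      ENNReal.ofReal_pow (by positivity), ENNReal.ofReal_natCast, ENNReal.ofReal_natCast,
      ENNReal.ofReal_coe_nnreal]
  rw [hlhs]
  apply ENNReal.ofReal_le_ofReal
  have hfac : 0 ≤ (L : ℝ) ^ (n + j + 1) - (L : ℝ) ^ (n + j) := by
    rw [pow_succ]
    nlinarith [pow_pos hLpos (n + j)]
  rw [hcast]
  calc (L : ℝ) ^ n * (((L : ℝ) ^ (n + j + 1) - (L : ℝ) ^ (n + j)) * (levelWeight J (n + j + 1) : ℝ))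
      ≤ (L : ℝ) ^ n * (((L : ℝ) ^ (n + j + 1) - (L : ℝ) ^ (n + j)) *
          (b * ((L : ℝ)⁻¹ * ((L : ℝ) ^ (2 * (n + j)))⁻¹ * (Real.log n + (j + 1 + L))))) := by
        gcongr
        exact hw.trans (by gcongr)
    _ = b * (g j * (Real.log n + (j + 1 + L))) := by
        simp only [hg, inv_pow]
        have h1 : (L : ℝ) ^ (2 * (n + j)) = (L ^ n) * L ^ (n + j) * L ^ j := by ring
        rw [h1]
        field_simp
        ring

end Weight

/-! ### Percolation events: dependence on edges, probabilities, translation invariance -/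

section Percolation

variable {L : ℕ}

open scoped Classical in
/-- The potential edges among a finite set of unordered pairs. -/
noncomputable def edgesOf (F : Finset (Sym2 (HierLattice L))) : Finset (HierEdge L) :=
  F.subtype fun e => ¬ e.IsDiag

theorem mem_edgesOf {F : Finset (Sym2 (HierLattice L))} {e : HierEdge L} :
    e ∈ edgesOf F ↔ e.1 ∈ F := by
  rw [edgesOf, Finset.mem_subtype]

theorem disjoint_edgesOf {F F' : Finset (Sym2 (HierLattice L))} (h : Disjoint F F') :
    Disjoint (edgesOf F) (edgesOf F') :=
  Finset.disjoint_left.2 fun _ h1 h2 =>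
    Finset.disjoint_left.1 h (mem_edgesOf.1 h1) (mem_edgesOf.1 h2)

theorem openGraph_adj_congr {F : Finset (Sym2 (HierLattice L))} {ω ω' : HierEdge L → Bool}
    (h : ∀ e ∈ (edgesOf F : Set (HierEdge L)), ω e = ω' e) {x y : HierLattice L}
    (hxy : s(x, y) ∈ F) : (openGraph ω).Adj x y ↔ (openGraph ω').Adj x y := by
  refine exists_congr fun hd => ?_
  rw [h _ (mem_edgesOf.2 hxy)]

theorem openGraph_within_congr {R : Finset (HierLattice L)} {ω ω' : HierEdge L → Bool}
    (h : ∀ e ∈ (edgesOf R.sym2 : Set (HierEdge L)), ω e = ω' e) :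
    (openGraph ω).within R = (openGraph ω').within R := by
  ext x y
  refine and_congr_left fun hR => openGraph_adj_congr h ?_
  exact Finset.mk_mem_sym2_iff.2 ⟨hR.1, hR.2⟩

theorem localCluster_congr {R : Finset (HierLattice L)} {ω ω' : HierEdge L → Bool}
    (h : ∀ e ∈ (edgesOf R.sym2 : Set (HierEdge L)), ω e = ω' e) (x : HierLattice L) :
    localCluster (openGraph ω) R x = localCluster (openGraph ω') R x := by
  rw [localCluster, localCluster, openGraph_within_congr h]

theorem dependsOn_adj (x y : HierLattice L) :
    DependsOn (· ∈ {ω : HierEdge L → Bool | (openGraph ω).Adj x y})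
      (edgesOf {s(x, y)} : Set (HierEdge L)) :=
  fun _ _ h => propext (openGraph_adj_congr h (Finset.mem_singleton_self _))

theorem dependsOn_localCluster (R : Finset (HierLattice L)) (x : HierLattice L)
    (P : Set (HierLattice L) → Prop) :
    DependsOn (· ∈ {ω : HierEdge L → Bool | P (localCluster (openGraph ω) R x)})
      (edgesOf R.sym2 : Set (HierEdge L)) := fun _ _ h => by
  simp only [Set.mem_ofPred_eq]
  rw [localCluster_congr h x]

variable (J : HierEdge L → ℝ≥0)

theorem toNNReal_openProb (e : HierEdge L) :
    (unitInterval.toNNReal (openProb J e) : ℝ≥0∞) = ENNReal.ofReal (1 - Real.exp (-(J e : ℝ))) := by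
  rw [ENNReal.ofReal, ENNReal.coe_inj]
  exact NNReal.eq (Real.coe_toNNReal _ (openProb J e).2.1).symm

theorem toNNReal_symm_openProb (e : HierEdge L) :
    (unitInterval.toNNReal (unitInterval.symm (openProb J e)) : ℝ≥0∞) =
      ENNReal.ofReal (Real.exp (-(J e : ℝ))) := by
  rw [ENNReal.ofReal, ENNReal.coe_inj]
  refine NNReal.eq ?_
  rw [Real.coe_toNNReal _ (Real.exp_pos _).le]
  change 1 - (1 - Real.exp (-(J e : ℝ))) = _
  ring

theorem percMeasure_adj_le (x y : HierLattice L) :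
    percMeasure J {ω | (openGraph ω).Adj x y} ≤ pairWeight J x y := by
  classical
  by_cases h : (s(x, y)).IsDiag
  · have : {ω : HierEdge L → Bool | (openGraph ω).Adj x y} = ∅ :=
      Set.eq_empty_of_forall_notMem fun ω hω => hω.1 h
    rw [this, measure_empty]
    exact zero_le
  · have : {ω : HierEdge L → Bool | (openGraph ω).Adj x y} =
        Set.pi (({⟨s(x, y), h⟩} : Finset (HierEdge L)) : Set (HierEdge L)) fun _ => {true} := by
      ext ω
      simp only [Set.mem_ofPred_eq, Set.mem_pi, Finset.coe_singleton, Set.mem_singleton_iff,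
        forall_eq]
      exact ⟨fun ⟨_, hω⟩ => hω, fun hω => ⟨h, hω⟩⟩
    rw [this, percMeasure, Measure.infinitePi_pi _ fun _ _ => measurableSet_singleton _,
      Finset.prod_singleton, ProbabilityTheory.bernoulliMeasure_apply_of_mem_of_notMem _
        (measurableSet_singleton _) (by simp) (by simp), toNNReal_openProb, pairWeight, dif_pos h,
      ← ENNReal.ofReal_coe_nnreal]
    apply ENNReal.ofReal_le_ofReal
    have := Real.add_one_le_exp (-(J ⟨s(x, y), h⟩ : ℝ))
    linarith

/-- The event that no edge between `B` and `D` is open. -/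
def noOpenEdge (B D : Finset (HierLattice L)) : Set (HierEdge L → Bool) :=
  {ω | ∀ x ∈ B, ∀ y ∈ D, ¬ (openGraph ω).Adj x y}

open scoped Classical in
/-- The unordered pairs between `B` and `D`. -/
noncomputable def pairsBetween (B D : Finset (HierLattice L)) : Finset (Sym2 (HierLattice L)) :=
  (B ×ˢ D).image fun p => s(p.1, p.2)

theorem mk_mem_pairsBetween {B D : Finset (HierLattice L)} {x y : HierLattice L} (hx : x ∈ B)
    (hy : y ∈ D) : s(x, y) ∈ pairsBetween B D :=
  Finset.mem_image.2 ⟨(x, y), Finset.mem_product.2 ⟨hx, hy⟩, rfl⟩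

theorem mem_pairsBetween {B D : Finset (HierLattice L)} {e : Sym2 (HierLattice L)} :
    e ∈ pairsBetween B D ↔ ∃ x ∈ B, ∃ y ∈ D, s(x, y) = e := by
  simp [pairsBetween, and_assoc]

theorem dependsOn_noOpenEdge (B D : Finset (HierLattice L)) :
    DependsOn (· ∈ noOpenEdge B D) (edgesOf (pairsBetween B D) : Set (HierEdge L)) :=
  fun _ _ h => propext <| forall₂_congr fun _ hx => forall₂_congr fun _ hy =>
    not_congr (openGraph_adj_congr h (mk_mem_pairsBetween hx hy))

theorem percMeasure_noOpenEdge {B D : Finset (HierLattice L)} (hBD : Disjoint B D) :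
    percMeasure J (noOpenEdge B D) =
      ENNReal.ofReal (Real.exp (-∑ x ∈ B, ∑ y ∈ D, (pairWeight J x y : ℝ))) := by
  classical
  have hset : noOpenEdge B D =
      Set.pi (edgesOf (pairsBetween B D) : Set (HierEdge L)) fun _ => {false} := by
    ext ω
    simp only [noOpenEdge, Set.mem_ofPred_eq, Set.mem_pi, Finset.mem_coe, mem_edgesOf,
      Set.mem_singleton_iff]
    constructor
    · rintro h ⟨e, he⟩ hmem
      obtain ⟨x, hx, y, hy, rfl⟩ := mem_pairsBetween.1 hmem
      by_contra hne
      exact h x hx y hy ⟨he, by simpa using hne⟩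
    · rintro h x hx y hy ⟨hd, hω⟩
      rw [h _ (mk_mem_pairsBetween hx hy)] at hω
      exact Bool.false_ne_true hω
  have hd : ∀ e ∈ pairsBetween B D, ¬ e.IsDiag := by
    intro e he
    obtain ⟨x, hx, y, hy, rfl⟩ := mem_pairsBetween.1 he
    rw [Sym2.mk_isDiag_iff]
    rintro rfl
    exact Finset.disjoint_left.1 hBD hx hy
  rw [hset, percMeasure, Measure.infinitePi_pi _ fun _ _ => measurableSet_singleton _,
    Finset.prod_congr rfl (g := fun e : HierEdge L =>
      (fun s : Sym2 (HierLattice L) => if h : ¬ s.IsDiag then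
        ENNReal.ofReal (Real.exp (-(J ⟨s, h⟩ : ℝ))) else 1) e.1), edgesOf,
    Finset.prod_subtype_of_mem (fun s : Sym2 (HierLattice L) => if h : ¬ s.IsDiag then
        ENNReal.ofReal (Real.exp (-(J ⟨s, h⟩ : ℝ))) else 1) hd, pairsBetween, Finset.prod_image]
  · rw [← Finset.sum_product' B D fun x y => (pairWeight J x y : ℝ), ← Finset.sum_neg_distrib,
      Real.exp_sum, ENNReal.ofReal_prod_of_nonneg fun _ _ => (Real.exp_pos _).le]
    refine Finset.prod_congr rfl fun p _ => ?_
    simp only [pairWeight]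
    by_cases h : (s(p.1, p.2)).IsDiag
    · rw [dif_neg (not_not.2 h), dif_neg (not_not.2 h)]
      simp
    · rw [dif_pos h, dif_pos h]
  · rintro ⟨x, y⟩ h1 ⟨x', y'⟩ h2 h
    simp only [Finset.coe_product, Set.mem_prod, Finset.mem_coe] at h1 h2
    rw [Sym2.eq_iff] at h
    rcases h with ⟨rfl, rfl⟩ | ⟨rfl, rfl⟩
    · rfl
    · exact absurd h2.2 (Finset.disjoint_left.1 hBD h1.1)
  · intro e _
    rw [ProbabilityTheory.bernoulliMeasure_apply_of_notMem_of_mem _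
        (measurableSet_singleton _) (by simp) (by simp), toNNReal_symm_openProb]
    dsimp only
    rw [dif_pos e.2]

theorem percMeasure_inter_of_dependsOn {A B : Set (HierEdge L → Bool)}
    {S T : Finset (Sym2 (HierLattice L))}
    (hA : DependsOn (· ∈ A) (edgesOf S : Set (HierEdge L)))
    (hB : DependsOn (· ∈ B) (edgesOf T : Set (HierEdge L))) (hST : Disjoint S T) :
    percMeasure J (A ∩ B) = percMeasure J A * percMeasure J B :=
  infinitePi_inter_of_dependsOn _ hA hB (disjoint_edgesOf hST)

/-- The event that the cluster of `x` has at least `M` points. -/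
def largeCluster (M : ℕ) (x : HierLattice L) : Set (HierEdge L → Bool) :=
  {ω | (M : ℕ∞) ≤ (openCluster ω x).encard}

theorem exists_mem_localCluster_hierBall [NeZero L] {ω : HierEdge L → Bool} {x y : HierLattice L}
    (h : y ∈ openCluster ω x) : ∃ n, y ∈ localCluster (openGraph ω) (hierBall L n) x := by
  obtain ⟨p⟩ := h
  obtain ⟨n, hn⟩ : ∃ n, ∀ z ∈ p.support, z ∈ hierBall L n := by
    refine ⟨p.support.toFinset.sup (hierLevel 0), fun z hz => ?_⟩
    rw [mem_hierBall_iff_level]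
    exact Finset.le_sup (List.mem_toFinset.2 hz)
  refine ⟨n, ?_⟩
  have := p.reachable_within (R := (hierBall L n : Set (HierLattice L))) (Nat.zero_le _) le_rfl
    fun k _ _ => hn _ (p.getVert_mem_support k)
  rwa [SimpleGraph.Walk.getVert_zero, SimpleGraph.Walk.getVert_length] at this

theorem localCluster_mono (G : SimpleGraph (HierLattice L)) {R R' : Set (HierLattice L)}
    (h : R ⊆ R') (x : HierLattice L) : localCluster G R x ⊆ localCluster G R' x :=
  fun _ hy => SimpleGraph.Reachable.mono
    (show G.within R ≤ G.within R' from fun _ _ h' => ⟨h'.1, h h'.2.1, h h'.2.2⟩) hy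

/-- `M` points of a cluster are reached by finitely many finite paths, all inside one ball. This
expresses the event through events on finitely many edges and so yields its measurability. -/
theorem largeCluster_eq_iUnion [NeZero L] (M : ℕ) (x : HierLattice L) :
    largeCluster M x =
      ⋃ n, {ω | (M : ℕ∞) ≤ (localCluster (openGraph ω) (hierBall L n) x).encard} := by
  ext ω
  simp only [largeCluster, Set.mem_ofPred_eq, Set.mem_iUnion]
  constructor
  · intro h
    obtain ⟨t, ht, hcard⟩ := Set.exists_subset_encard_eq h
    have hfin : t.Finite := Set.finite_of_encard_eq_coe hcard
    choose! f hf using fun y (hy : y ∈ t) => exists_mem_localCluster_hierBall (ht hy)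
    refine ⟨hfin.toFinset.sup f, hcard.symm.le.trans (Set.encard_le_encard fun y hy => ?_)⟩
    refine localCluster_mono _ ?_ x (hf y hy)
    exact_mod_cast hierBall_mono (Finset.le_sup (hfin.mem_toFinset.2 hy))
  · rintro ⟨n, hn⟩
    exact hn.trans (Set.encard_le_encard (localCluster_subset_cluster _ _ _))

theorem measurableSet_largeCluster [NeZero L] (M : ℕ) (x : HierLattice L) :
    MeasurableSet (largeCluster M x) := by
  rw [largeCluster_eq_iUnion]
  exact MeasurableSet.iUnion fun n =>
    (dependsOn_localCluster (hierBall L n) x fun K => (M : ℕ∞) ≤ K.encard).measurableSet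

/-- Translation of edges. -/
noncomputable def shiftEdge (z : HierLattice L) (e : HierEdge L) : HierEdge L :=
  ⟨Sym2.map (· + z) e.1, by
    rw [Sym2.isDiag_map (add_left_injective z)]
    exact e.2⟩

theorem shiftEdge_injective (z : HierLattice L) : Function.Injective (shiftEdge z) :=
  fun _ _ h => Subtype.ext (Sym2.map.injective (add_left_injective z) (congrArg Subtype.val h))

theorem length_shiftEdge (z : HierLattice L) (e : HierEdge L) :
    (shiftEdge z e).length = e.length := by
  obtain ⟨e, he⟩ := e
  induction e using Sym2.ind with
  | _ x y =>
    have h2 := (shiftEdge z ⟨s(x, y), he⟩).2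
    exact (HierEdge.length_mk h2).trans
      ((congrArg _ (hierLevel_add_right x y z)).trans (HierEdge.length_mk he).symm)

variable {J}

/-- Translating the edges preserves lengths, hence the product measure, and carries the cluster of
the origin to that of `z`. -/
theorem percMeasure_largeCluster [NeZero L] (hJ : IsIsometryInvariant J) (M : ℕ)
    (z : HierLattice L) :
    percMeasure J (largeCluster M z) = percMeasure J (largeCluster M 0) := by
  have hprob : ∀ e, openProb J (shiftEdge z e) = openProb J e := fun e =>
    Subtype.ext (by simp only [openProb, hJ _ _ (length_shiftEdge z e)])
  have hmap : (percMeasure J).map (fun ω e => ω (shiftEdge z e)) = percMeasure J := by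
    rw [percMeasure, Measure.map_infinitePi_infinitePi_of_inj (shiftEdge_injective z)]
    simp only [hprob]
  have hadj : ∀ (ω : HierEdge L → Bool) (x y : HierLattice L),
      (openGraph fun e => ω (shiftEdge z e)).Adj x y ↔ (openGraph ω).Adj (x + z) (y + z) := by
    intro ω x y
    have hd : (s(x + z, y + z)).IsDiag ↔ (s(x, y)).IsDiag := by simp
    exact ⟨fun ⟨h, hω⟩ => ⟨fun h' => h (hd.1 h'), hω⟩, fun ⟨h, hω⟩ => ⟨fun h' => h (hd.2 h'), hω⟩⟩
  have hpre : largeCluster M z = (fun ω e => ω (shiftEdge z e)) ⁻¹' largeCluster M 0 := by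
    ext ω
    simp only [largeCluster, Set.mem_ofPred_eq, Set.mem_preimage]
    let φ : (openGraph fun e => ω (shiftEdge z e)) ≃g openGraph ω :=
      { Equiv.addRight z with map_rel_iff' := (hadj ω _ _).symm }
    have hφ0 : φ 0 = z := zero_add z
    have himg : openCluster ω z = φ '' openCluster (fun e => ω (shiftEdge z e)) 0 := by
      ext y
      constructor
      · intro hy
        refine ⟨φ.symm y, ?_, φ.apply_symm_apply y⟩
        refine (SimpleGraph.Iso.reachable_iff (φ := φ)).1 ?_
        rw [hφ0, φ.apply_symm_apply]
        exact hy
      · rintro ⟨x, hx, rfl⟩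
        have := (SimpleGraph.Iso.reachable_iff (φ := φ)).2 hx
        rwa [hφ0] at this
    rw [himg, φ.injective.encard_image]
  rw [hpre, ← Measure.map_apply (by fun_prop) (measurableSet_largeCluster M 0), hmap]

theorem tendsto_largeCluster [NeZero L] :
    Tendsto (fun M => (percMeasure J).real (largeCluster M (0 : HierLattice L))) atTop
      (nhds (clusterDensity J)) := by
  have hinter : {ω : HierEdge L → Bool | (openCluster ω 0).Infinite} =
      ⋂ M, largeCluster M (0 : HierLattice L) := by
    ext ω
    simp only [Set.mem_ofPred_eq, Set.mem_iInter, largeCluster]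
    rw [← Set.encard_eq_top_iff]
    constructor
    · intro h M
      rw [h]
      exact le_top
    · intro h
      exact ENat.eq_top_iff_forall_ge.2 h
  rw [clusterDensity, hinter]
  refine (ENNReal.tendsto_toReal (measure_ne_top _ _)).comp ?_
  refine tendsto_measure_iInter_atTop (fun M => (measurableSet_largeCluster M 0).nullMeasurableSet)
    (fun M N hMN ω hω => ?_) ⟨0, measure_ne_top _ _⟩
  exact le_trans (Nat.cast_le.2 hMN) (show (N : ℕ∞) ≤ _ from hω)

end Percolation

/-- Stands in for conditioning on a random variable with finitely many values. -/
theorem measureReal_eq_sum_fibers {Ω α : Type*} [MeasurableSpace Ω] (μ : Measure Ω)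
    [IsFiniteMeasure μ] {X : Ω → α} {T : Finset α} (hT : ∀ ω, X ω ∈ T)
    (hX : ∀ c, MeasurableSet {ω | X ω = c}) {S : Set Ω} (hS : MeasurableSet S) :
    μ.real S = ∑ c ∈ T, μ.real ({ω | X ω = c} ∩ S) := by
  rw [← measureReal_biUnion_finset]
  · congr 1
    ext ω
    simp [hT ω]
  · intro c _ d _ hcd
    refine Set.disjoint_left.2 fun ω h1 h2 => hcd ?_
    exact h1.1.symm.trans h2.1
  · exact fun c _ => (hX c).inter hS

/-! ### Probability bounds for joined clusters, dead ends and long edges -/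

section Bounds

variable {L : ℕ} {J : HierEdge L → ℝ≥0}

theorem disjoint_sym2 {α : Type*} {R R' : Finset α} (h : Disjoint R R') :
    Disjoint R.sym2 R'.sym2 := by
  refine Finset.disjoint_left.2 fun e h1 h2 => ?_
  induction e using Sym2.ind with
  | _ x y =>
    exact Finset.disjoint_left.1 h (Finset.mk_mem_sym2_iff.1 h1).1 (Finset.mk_mem_sym2_iff.1 h2).1

open scoped Classical in
/-- The points of `R` with a large local cluster. -/
noncomputable def largePoints (M : ℕ) (R : Finset (HierLattice L)) (ω : HierEdge L → Bool) :
    Finset (HierLattice L) :=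
  R.filter fun x => (M : ℕ∞) ≤ (localCluster (openGraph ω) R x).encard

theorem mem_largePoints {M : ℕ} {R : Finset (HierLattice L)} {ω : HierEdge L → Bool}
    {x : HierLattice L} : x ∈ largePoints M R ω ↔
      x ∈ R ∧ (M : ℕ∞) ≤ (localCluster (openGraph ω) R x).encard :=
  Finset.mem_filter

theorem dependsOn_largePoints (M : ℕ) (R : Finset (HierLattice L))
    (P : Finset (HierLattice L) → Prop) :
    DependsOn (· ∈ {ω : HierEdge L → Bool | P (largePoints M R ω)})
      (edgesOf R.sym2 : Set (HierEdge L)) := fun x y h => by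
  have : largePoints M R x = largePoints M R y := by
    ext z
    rw [mem_largePoints, mem_largePoints, localCluster_congr h z]
  simp only [Set.mem_ofPred_eq, this]

open scoped Classical in
/-- The unordered pairs that decide whether large local clusters of `R` and `R'` are joined. -/
noncomputable def joinPairs (R R' : Finset (HierLattice L)) : Finset (Sym2 (HierLattice L)) :=
  (R.sym2 ∪ R'.sym2) ∪ pairsBetween R R'

theorem dependsOn_inter_edgesOf [DecidableEq (Sym2 (HierLattice L))]
    {A B : Set (HierEdge L → Bool)} {F F' : Finset (Sym2 (HierLattice L))}
    (hA : DependsOn (· ∈ A) (edgesOf F : Set (HierEdge L)))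
    (hB : DependsOn (· ∈ B) (edgesOf F' : Set (HierEdge L))) :
    DependsOn (· ∈ A ∩ B) (edgesOf (F ∪ F') : Set (HierEdge L)) := by
  refine (dependsOn_inter hA hB).mono_set fun e he => ?_
  rw [Finset.mem_coe, mem_edgesOf, Finset.mem_union]
  exact he.imp mem_edgesOf.1 mem_edgesOf.1

theorem dependsOn_not_largeClustersJoined (R R' : Finset (HierLattice L)) (M : ℕ) :
    DependsOn (· ∈ {ω : HierEdge L → Bool | ¬ LargeClustersJoined (openGraph ω) R R' M})
      (edgesOf (joinPairs R R') : Set (HierEdge L)) := fun ω ω' h => by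
  classical
  have h1 : ∀ x, localCluster (openGraph ω) R x = localCluster (openGraph ω') R x :=
    localCluster_congr fun e he => h e <| mem_edgesOf.2 <| by
      simp only [joinPairs, Finset.mem_union]
      exact Or.inl (Or.inl (mem_edgesOf.1 he))
  have h2 : ∀ x, localCluster (openGraph ω) R' x = localCluster (openGraph ω') R' x :=
    localCluster_congr fun e he => h e <| mem_edgesOf.2 <| by
      simp only [joinPairs, Finset.mem_union]
      exact Or.inl (Or.inr (mem_edgesOf.1 he))
  refine propext (not_congr ?_)
  refine exists_congr fun x => and_congr_right fun hx => exists_congr fun y =>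
    and_congr_right fun hy => ?_
  rw [h1, h2, openGraph_adj_congr h]
  simp only [joinPairs, Finset.mem_union]
  exact Or.inr (mk_mem_pairsBetween hx hy)

/-- Large local clusters of disjoint sets are not joined with probability at least
`exp (-θ_M ^ 2 * J(R, R'))`. -/
theorem exp_neg_le_measureReal_not_largeClustersJoined [NeZero L] (hJ : IsIsometryInvariant J)
    {R R' : Finset (HierLattice L)} (hR : Disjoint R R') (M : ℕ) {a : ℝ}
    (ha : (percMeasure J).real (largeCluster M 0) ^ 2 *
      ∑ x ∈ R, ∑ y ∈ R', (pairWeight J x y : ℝ) ≤ a) :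
    Real.exp (-a) ≤
      (percMeasure J).real {ω | ¬ LargeClustersJoined (openGraph ω) R R' M} := by
  classical
  set μ := percMeasure J with hμ
  set θ := μ.real (largeCluster M 0) with hθ
  let X : (HierEdge L → Bool) → Finset (HierLattice L) × Finset (HierLattice L) :=
    fun ω => (largePoints M R ω, largePoints M R' ω)
  let T := R.powerset ×ˢ R'.powerset
  let w : Finset (HierLattice L) × Finset (HierLattice L) → ℝ :=
    fun c => ∑ x ∈ c.1, ∑ y ∈ c.2, (pairWeight J x y : ℝ)
  have hT : ∀ ω, X ω ∈ T := fun ω => Finset.mem_product.2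
    ⟨Finset.mem_powerset.2 (Finset.filter_subset _ _),
      Finset.mem_powerset.2 (Finset.filter_subset _ _)⟩
  have hdep : ∀ c, DependsOn (· ∈ {ω | X ω = c})
      (edgesOf (R.sym2 ∪ R'.sym2) : Set (HierEdge L)) := by
    intro c
    have h1 := dependsOn_inter_edgesOf (dependsOn_largePoints M R (· = c.1))
      (dependsOn_largePoints M R' (· = c.2))
    have h2 : {ω | X ω = c} = {ω | largePoints M R ω = c.1} ∩ {ω | largePoints M R' ω = c.2} := by
      ext ω
      exact Prod.ext_iff
    rwa [h2]
  have hX : ∀ c, MeasurableSet {ω | X ω = c} := fun c => (hdep c).measurableSet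
  -- The large points are determined by the edges inside `R` and inside `R'`. The edges between `R`
  -- and `R'` are independent of these, so on each fiber the factor is the exact probability that no
  -- edge between the two given sets is open.
  have hprod : ∀ c ∈ T, μ.real ({ω | X ω = c} ∩
      {ω | ¬ LargeClustersJoined (openGraph ω) R R' M}) =
        μ.real {ω | X ω = c} * Real.exp (-w c) := by
    intro c hc
    obtain ⟨hc1, hc2⟩ := Finset.mem_product.1 hc
    rw [Finset.mem_powerset] at hc1 hc2
    have hset : {ω | X ω = c} ∩ {ω | ¬ LargeClustersJoined (openGraph ω) R R' M} =
        {ω | X ω = c} ∩ noOpenEdge c.1 c.2 := by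
      ext ω
      refine and_congr_right ?_
      rintro (rfl : X ω = c)
      constructor
      · intro h x hx y hy hadj
        obtain ⟨hxR, hxM⟩ := mem_largePoints.1 hx
        obtain ⟨hyR, hyM⟩ := mem_largePoints.1 hy
        exact h ⟨x, hxR, y, hyR, hadj, hxM, hyM⟩
      · rintro h ⟨x, hxR, y, hyR, hadj, hxM, hyM⟩
        exact h x (mem_largePoints.2 ⟨hxR, hxM⟩) y (mem_largePoints.2 ⟨hyR, hyM⟩) hadj
    have hdisj : Disjoint (R.sym2 ∪ R'.sym2) (pairsBetween c.1 c.2) := by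
      refine Finset.disjoint_left.2 fun e h1 h2 => ?_
      obtain ⟨x, hx, y, hy, rfl⟩ := mem_pairsBetween.1 h2
      rw [Finset.mem_union, Finset.mk_mem_sym2_iff, Finset.mk_mem_sym2_iff] at h1
      rcases h1 with h1 | h1
      · exact Finset.disjoint_left.1 hR h1.2 (hc2 hy)
      · exact Finset.disjoint_left.1 hR (hc1 hx) h1.1
    rw [hset, measureReal_def, percMeasure_inter_of_dependsOn J (hdep c)
      (dependsOn_noOpenEdge c.1 c.2) hdisj, ENNReal.toReal_mul,
      percMeasure_noOpenEdge J (Disjoint.mono hc1 hc2 hR),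
      ENNReal.toReal_ofReal (Real.exp_pos _).le, measureReal_def]
  have hone : ∑ c ∈ T, μ.real {ω | X ω = c} = 1 := by
    have := measureReal_eq_sum_fibers μ hT hX MeasurableSet.univ
    simp only [Set.inter_univ] at this
    rw [← this]
    simp
  -- The clusters inside `R` and inside `R'` use disjoint sets of edges, and each is contained in a
  -- full cluster; this yields the square of `θ`.
  have hpair : ∀ x ∈ R, ∀ y ∈ R', μ.real {ω | x ∈ (X ω).1 ∧ y ∈ (X ω).2} ≤ θ ^ 2 := by
    intro x _ y _
    have h1 := percMeasure_inter_of_dependsOn J (dependsOn_largePoints M R (x ∈ ·))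
      (dependsOn_largePoints M R' (y ∈ ·)) (disjoint_sym2 hR)
    have hle : ∀ (R : Finset (HierLattice L)) x,
        μ.real {ω | x ∈ largePoints M R ω} ≤ θ := by
      intro R x
      rw [hθ, measureReal_def, measureReal_def, ← percMeasure_largeCluster hJ M x]
      refine ENNReal.toReal_mono (measure_ne_top _ _) (measure_mono fun ω hω => ?_)
      exact (mem_largePoints.1 hω).2.trans (Set.encard_le_encard
        (localCluster_subset_cluster _ _ _))
    calc μ.real {ω | x ∈ (X ω).1 ∧ y ∈ (X ω).2}
        = μ.real {ω | x ∈ largePoints M R ω} * μ.real {ω | y ∈ largePoints M R' ω} := by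
          rw [measureReal_def, measureReal_def, measureReal_def, ← ENNReal.toReal_mul, ← h1]
          rfl
      _ ≤ θ * θ := mul_le_mul (hle R x) (hle R' y) measureReal_nonneg measureReal_nonneg
      _ = θ ^ 2 := (sq θ).symm
  have hmean : ∑ c ∈ T, μ.real {ω | X ω = c} * w c ≤ a := by
    have hexp : ∀ c ∈ T, μ.real {ω | X ω = c} * w c = ∑ x ∈ R, ∑ y ∈ R',
        (pairWeight J x y : ℝ) *
          μ.real ({ω | X ω = c} ∩ {ω | x ∈ (X ω).1 ∧ y ∈ (X ω).2}) := by
      intro c hc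
      obtain ⟨hc1, hc2⟩ := Finset.mem_product.1 hc
      rw [Finset.mem_powerset] at hc1 hc2
      have hval : ∀ x y, μ.real ({ω | X ω = c} ∩ {ω | x ∈ (X ω).1 ∧ y ∈ (X ω).2}) =
          if x ∈ c.1 then if y ∈ c.2 then μ.real {ω | X ω = c} else 0 else 0 := by
        intro x y
        have hs : {ω | X ω = c} ∩ {ω | x ∈ (X ω).1 ∧ y ∈ (X ω).2} =
            if x ∈ c.1 then if y ∈ c.2 then {ω | X ω = c} else ∅ else ∅ := by
          ext ω
          split_ifs with h1 h2 <;>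
          simp only [Set.mem_inter_iff, Set.mem_ofPred_eq, Set.mem_empty_iff_false, iff_false,
            not_and] <;>
          [(refine and_iff_left_of_imp ?_); skip; skip] <;>
          · rintro rfl
            simp_all
        rw [hs]
        split_ifs <;> simp
      simp only [w, Finset.mul_sum]
      rw [← Finset.sum_subset hc1]
      · refine Finset.sum_congr rfl fun x hx => ?_
        rw [← Finset.sum_subset hc2]
        · refine Finset.sum_congr rfl fun y hy => ?_
          rw [hval, if_pos hx, if_pos hy, mul_comm]
        · intro y _ hy
          rw [hval, if_pos hx, if_neg hy, mul_zero]
      · intro x _ hx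
        refine Finset.sum_eq_zero fun y _ => ?_
        rw [hval, if_neg hx, mul_zero]
    rw [Finset.sum_congr rfl hexp, Finset.sum_comm]
    refine le_trans ?_ ha
    rw [Finset.mul_sum]
    refine Finset.sum_le_sum fun x hx => ?_
    rw [Finset.sum_comm, Finset.mul_sum]
    refine Finset.sum_le_sum fun y hy => ?_
    have hm : MeasurableSet {ω | x ∈ (X ω).1 ∧ y ∈ (X ω).2} :=
      (dependsOn_inter_edgesOf (dependsOn_largePoints M R (x ∈ ·))
        (dependsOn_largePoints M R' (y ∈ ·))).measurableSet
    rw [← Finset.mul_sum, ← measureReal_eq_sum_fibers μ hT hX hm, mul_comm]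
    exact mul_le_mul_of_nonneg_right (hpair x hx y hy) (NNReal.coe_nonneg _)
  rw [measureReal_eq_sum_fibers μ hT hX (dependsOn_not_largeClustersJoined R R' M).measurableSet,
    Finset.sum_congr rfl hprod]
  -- Jensen's inequality by hand: the exponential lies above its tangent at `-a`, and the mean of
  -- `w` is at most `a`.
  calc Real.exp (-a) ≤ Real.exp (-a) * ((1 + a) * ∑ c ∈ T, μ.real {ω | X ω = c} -
        ∑ c ∈ T, μ.real {ω | X ω = c} * w c) := by
        rw [hone]
        exact le_mul_of_one_le_right (Real.exp_pos _).le (by linarith)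
    _ = ∑ c ∈ T, μ.real {ω | X ω = c} * (Real.exp (-a) * (1 + (a - w c))) := by
        rw [Finset.mul_sum, ← Finset.sum_sub_distrib, Finset.mul_sum]
        exact Finset.sum_congr rfl fun c _ => by ring
    _ ≤ ∑ c ∈ T, μ.real {ω | X ω = c} * Real.exp (-w c) := by
        refine Finset.sum_le_sum fun c _ => mul_le_mul_of_nonneg_left ?_ measureReal_nonneg
        have h1 : Real.exp (-w c) = Real.exp (-a) * Real.exp (a - w c) := by
          rw [← Real.exp_add]
          ring_nf
        rw [h1]
        refine mul_le_mul_of_nonneg_left ?_ (Real.exp_pos _).le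
        linarith [Real.add_one_le_exp (a - w c)]

/-- The expected size of a cluster on the event that it has less than `M` points is at most
`M`. -/
theorem sum_percMeasure_mem_small_le (R : Finset (HierLattice L)) (M : ℕ) (w : HierLattice L) :
    ∑ w' ∈ R, percMeasure J {ω | w' ∈ localCluster (openGraph ω) R w ∧
      (localCluster (openGraph ω) R w).encard < M} ≤ M := by
  classical
  have hm : ∀ w', MeasurableSet {ω : HierEdge L → Bool | w' ∈ localCluster (openGraph ω) R w ∧
      (localCluster (openGraph ω) R w).encard < M} := fun w' =>
    (dependsOn_localCluster R w fun K => w' ∈ K ∧ K.encard < M).measurableSet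
  calc _ = ∑ w' ∈ R, ∫⁻ ω, {ω : HierEdge L → Bool | w' ∈ localCluster (openGraph ω) R w ∧
      (localCluster (openGraph ω) R w).encard < M}.indicator 1 ω ∂(percMeasure J) :=
        Finset.sum_congr rfl fun w' _ => (lintegral_indicator_one (hm w')).symm
    _ = ∫⁻ ω, ∑ w' ∈ R, {ω : HierEdge L → Bool | w' ∈ localCluster (openGraph ω) R w ∧
      (localCluster (openGraph ω) R w).encard < M}.indicator 1 ω ∂(percMeasure J) :=
        (lintegral_finsetSum R fun w' _ => measurable_one.indicator (hm w')).symm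
    _ ≤ ∫⁻ _, M ∂(percMeasure J) := by
        refine lintegral_mono fun ω => ?_
        simp only [Set.indicator_apply, Set.mem_ofPred_eq, Pi.one_apply]
        rw [← Finset.sum_filter, Finset.sum_const, nsmul_eq_mul, mul_one]
        by_cases hs : (localCluster (openGraph ω) R w).encard < M
        · have h1 : ((R.filter fun w' => w' ∈ localCluster (openGraph ω) R w ∧
              (localCluster (openGraph ω) R w).encard < M : Finset _) : Set _).encard ≤ M :=
            (Set.encard_le_encard fun y hy => (Finset.mem_filter.1 hy).2.1).trans hs.le
          rw [Set.encard_coe_eq_coe_finsetCard] at h1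
          exact_mod_cast h1
        · simp [hs]
    _ = M := by simp

/-- A union bound over the two edges `w u` and `w' u'` leaving a small cluster. These are distinct
and not inside `R`, so they are independent of each other and of the cluster. The first edge is
summed over the whole boundary of `R`. Given it, the expected number of choices of `w'` is at most
`M`, and the edges leaving each `w'` have weight at most `τ`. -/
theorem percMeasure_not_smallClustersDeadEnd_le [NeZero L] (R : Finset (HierLattice L)) (M : ℕ)
    [DecidablePred (· ∉ R)] {τ : ℝ≥0∞}
    (hτ : ∀ w ∈ R, ∑' u, (if u ∉ R then (pairWeight J w u : ℝ≥0∞) else 0) ≤ τ) :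
    percMeasure J {ω | ¬ SmallClustersDeadEnd (openGraph ω) R M} ≤
      (∑ w ∈ R, ∑' u, if u ∉ R then (pairWeight J w u : ℝ≥0∞) else 0) * (τ * M) := by
  classical
  set μ := percMeasure J
  let E : HierLattice L → HierLattice L → HierLattice L → HierLattice L →
      Set (HierEdge L → Bool) := fun w u w' u' =>
    {ω | w' ∈ R ∧ u ∉ R ∧ u' ∉ R ∧ u ≠ u' ∧ (openGraph ω).Adj w u ∧ (openGraph ω).Adj w' u' ∧
      w' ∈ localCluster (openGraph ω) R w ∧ (localCluster (openGraph ω) R w).encard < M}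
  let S : HierLattice L → HierLattice L → Set (HierEdge L → Bool) := fun w w' =>
    {ω | w' ∈ localCluster (openGraph ω) R w ∧ (localCluster (openGraph ω) R w).encard < M}
  let f : HierLattice L → HierLattice L → ℝ≥0∞ :=
    fun w u => if u ∉ R then (pairWeight J w u : ℝ≥0∞) else 0
  have hE : ∀ w ∈ R, ∀ u, ∀ w' ∈ R, ∀ u', μ (E w u w' u') ≤ f w u * (f w' u' * μ (S w w')) := by
    intro w hw u w' hw' u'
    by_cases h : u ∉ R ∧ u' ∉ R ∧ u ≠ u'
    · obtain ⟨hu, hu', huu'⟩ := h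
      have hsub : E w u w' u' ⊆ {ω | (openGraph ω).Adj w u} ∩
          ({ω | (openGraph ω).Adj w' u'} ∩ S w w') :=
        fun ω hω => ⟨hω.2.2.2.2.1, hω.2.2.2.2.2.1, hω.2.2.2.2.2.2⟩
      have hS := dependsOn_localCluster R w fun K => w' ∈ K ∧ K.encard < M
      refine (measure_mono hsub).trans ?_
      rw [percMeasure_inter_of_dependsOn J (dependsOn_adj w u)
        (dependsOn_inter_edgesOf (dependsOn_adj w' u') hS),
        percMeasure_inter_of_dependsOn J (dependsOn_adj w' u') hS]
      · simp only [f, if_pos hu, if_pos hu']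
        gcongr
        · exact percMeasure_adj_le J w u
        · exact percMeasure_adj_le J w' u'
      · rw [Finset.disjoint_singleton_left, Finset.mk_mem_sym2_iff]
        exact fun h => hu' h.2
      · rw [Finset.disjoint_singleton_left, Finset.mem_union, Finset.mem_singleton,
          Finset.mk_mem_sym2_iff, Sym2.eq_iff]
        rintro ((h | h) | h)
        · exact huu' h.2
        · exact hu' (h.1 ▸ hw)
        · exact hu h.2
    · have : E w u w' u' = ∅ := Set.eq_empty_of_forall_notMem fun ω hω =>
        h ⟨hω.2.1, hω.2.2.1, hω.2.2.2.1⟩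
      rw [this, measure_empty]
      exact zero_le
  have hsub : {ω | ¬ SmallClustersDeadEnd (openGraph ω) R M} ⊆
      ⋃ w ∈ R, ⋃ u, ⋃ w' ∈ R, ⋃ u', E w u w' u' := by
    intro ω hω
    simp only [Set.mem_ofPred_eq, SmallClustersDeadEnd, not_forall, not_le] at hω
    obtain ⟨w, hw, w', hw', u, hu, u', hu', huu', h1, h2, h3⟩ := hω
    have hwR : w' ∈ R := localCluster_subset hw hw'
    simp only [Set.mem_iUnion]
    exact ⟨w, hw, u, w', hwR, u', hwR, hu, hu', huu', h1, h2, hw', h3⟩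
  calc μ {ω | ¬ SmallClustersDeadEnd (openGraph ω) R M}
      ≤ μ (⋃ w ∈ R, ⋃ u, ⋃ w' ∈ R, ⋃ u', E w u w' u') := measure_mono hsub
    _ ≤ ∑ w ∈ R, ∑' u, ∑ w' ∈ R, ∑' u', μ (E w u w' u') := by
        refine (measure_biUnion_finset_le _ _).trans (Finset.sum_le_sum fun w _ => ?_)
        refine (measure_iUnion_le _).trans (ENNReal.tsum_le_tsum fun u => ?_)
        refine (measure_biUnion_finset_le _ _).trans (Finset.sum_le_sum fun w' _ => ?_)
        exact measure_iUnion_le _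
    _ ≤ ∑ w ∈ R, ∑' u, f w u * (τ * M) := by
        refine Finset.sum_le_sum fun w hw => ENNReal.tsum_le_tsum fun u => ?_
        calc ∑ w' ∈ R, ∑' u', μ (E w u w' u')
            ≤ ∑ w' ∈ R, f w u * (τ * μ (S w w')) := by
              refine Finset.sum_le_sum fun w' hw' => ?_
              refine (ENNReal.tsum_le_tsum fun u' => hE w hw u w' hw' u').trans ?_
              rw [ENNReal.tsum_mul_left, ENNReal.tsum_mul_right]
              gcongr
              exact hτ w' hw'
          _ ≤ f w u * (τ * M) := by
              rw [← Finset.mul_sum, ← Finset.mul_sum]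
              gcongr
              exact sum_percMeasure_mem_small_le R M w
    _ = _ := by
        rw [Finset.sum_mul]
        exact Finset.sum_congr rfl fun w _ => ENNReal.tsum_mul_right

theorem percMeasure_exists_adj_le [NeZero L] (A B : Finset (HierLattice L))
    [DecidablePred (· ∉ B)] :
    percMeasure J {ω | ∃ x ∈ A, ∃ y ∉ B, (openGraph ω).Adj x y} ≤
      ∑ x ∈ A, ∑' y, if y ∉ B then (pairWeight J x y : ℝ≥0∞) else 0 := by
  have hsub : {ω : HierEdge L → Bool | ∃ x ∈ A, ∃ y ∉ B, (openGraph ω).Adj x y} ⊆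
      ⋃ x ∈ A, ⋃ y, {ω | y ∉ B ∧ (openGraph ω).Adj x y} := by
    rintro ω ⟨x, hx, y, hy, h⟩
    simp only [Set.mem_iUnion]
    exact ⟨x, hx, y, hy, h⟩
  refine (measure_mono hsub).trans ((measure_biUnion_finset_le _ _).trans
    (Finset.sum_le_sum fun x _ => (measure_iUnion_le _).trans (ENNReal.tsum_le_tsum fun y => ?_)))
  by_cases hy : y ∉ B
  · rw [if_pos hy]
    exact (measure_mono fun ω hω => hω.2).trans (percMeasure_adj_le J x y)
  · rw [if_neg hy]
    simp [hy]

theorem exists_mem_of_mem_joinPairs {R R' : Finset (HierLattice L)} {x y : HierLattice L}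
    (h : s(x, y) ∈ joinPairs R R') : x ∈ R ∨ x ∈ R' := by
  classical
  simp only [joinPairs, Finset.mem_union, Finset.mk_mem_sym2_iff, mem_pairsBetween,
    Sym2.eq_iff] at h
  rcases h with (h | h) | ⟨u, hu, v, hv, ⟨rfl, rfl⟩ | ⟨rfl, rfl⟩⟩
  · exact Or.inl h.1
  · exact Or.inr h.1
  · exact Or.inl hu
  · exact Or.inr hv

end Bounds

/-! ### Growth of the block levels -/

section Blocks

/-- The levels that separate the annuli. -/
def blockLevel (j : ℕ) : ℕ := ∑ i ∈ Finset.range j, 8 * (Nat.log 2 (i + 1) + 1)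

theorem blockLevel_succ (j : ℕ) :
    blockLevel (j + 1) = blockLevel j + 8 * (Nat.log 2 (j + 1) + 1) :=
  Finset.sum_range_succ _ _

theorem blockLevel_strictMono : StrictMono blockLevel :=
  strictMono_nat_of_lt_succ fun j => by rw [blockLevel_succ]; omega

theorem mul_le_blockLevel (j : ℕ) : 8 * j ≤ blockLevel j := by
  induction j with
  | zero => exact Nat.zero_le _
  | succ j ih =>
    rw [blockLevel_succ]
    omega

theorem blockLevel_le (j : ℕ) : blockLevel j ≤ 8 * (j * (Nat.log 2 j + 1)) := by
  refine (Finset.sum_le_card_nsmul _ _ (8 * (Nat.log 2 j + 1)) fun i hi => ?_).trans (le_of_eq ?_)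
  · have := Nat.log_mono_right (b := 2) (show i + 1 ≤ j from Finset.mem_range.1 hi)
    omega
  · rw [Finset.card_range, smul_eq_mul]
    ring

theorem blockLevel_le_sq (j : ℕ) : blockLevel j ≤ 8 * j ^ 2 := by
  refine (blockLevel_le j).trans ?_
  rcases Nat.eq_zero_or_pos j with rfl | hj
  · simp
  · have := Nat.log_lt_self 2 hj.ne'
    rw [sq]
    gcongr
    omega

/-- The factor 8 in `blockLevel` makes each gap worth a power $(j+1)^8$, ample against boundary
weights that are polynomial in $j$. -/
theorem pow_le_pow_blockLevel_sub {L : ℕ} (hL : 2 ≤ L) (j : ℕ) :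
    (j + 1) ^ 8 ≤ L ^ (8 * (Nat.log 2 (j + 1) + 1)) := by
  rw [mul_comm, pow_mul]
  refine Nat.pow_le_pow_left ?_ 8
  exact (Nat.lt_pow_succ_log_self one_lt_two (j + 1)).le.trans (Nat.pow_le_pow_left hL _)

theorem pow_le_pow_blockLevel {L : ℕ} (hL : 2 ≤ L) (j : ℕ) :
    (j + 1) ^ 8 ≤ L ^ blockLevel j := by
  calc (j + 1) ^ 8 ≤ (2 ^ j) ^ 8 := Nat.pow_le_pow_left Nat.lt_two_pow_self 8
    _ ≤ (L ^ j) ^ 8 := Nat.pow_le_pow_left (Nat.pow_le_pow_left hL _) _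
    _ = L ^ (8 * j) := by rw [← pow_mul, mul_comm]
    _ ≤ L ^ blockLevel j := Nat.pow_le_pow_right (by omega) (mul_le_blockLevel j)

/-- Here $\log n_j\le\log j+\log\log j+O(1)$, and the room $1-c$ pays for the iterated logarithm. -/
theorem exists_mul_log_blockLevel_le {c : ℝ} (hc0 : 0 ≤ c) (hc1 : c < 1) :
    ∃ C : ℝ, ∀ j : ℕ, 1 ≤ j → c * Real.log (blockLevel j) ≤ Real.log j + C := by
  have hlog2 : 0 < Real.log 2 := Real.log_pos one_lt_two
  -- With this `δ`, the bound $\log(l+1)\le\delta(l+1)-1-\log\delta$ costs at most $(1-c)\log j$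
  -- plus a constant, as $l\log 2\le\log j$.
  set δ := (1 - c) * Real.log 2 with hδ
  have hδ0 : 0 < δ := mul_pos (by linarith) hlog2
  refine ⟨c * (Real.log 8 + δ - 1 - Real.log δ), fun j hj => ?_⟩
  have hj' : (1 : ℝ) ≤ j := by exact_mod_cast hj
  set l := Nat.log 2 j with hl
  have hlj : (l : ℝ) * Real.log 2 ≤ Real.log j := by
    rw [← Real.log_pow]
    refine Real.log_le_log (by positivity) ?_
    exact_mod_cast Nat.pow_log_le_self 2 (show j ≠ 0 by omega)
  have h1 : Real.log (blockLevel j) ≤ Real.log 8 + (Real.log j + Real.log (l + 1)) := by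
    have hpos : 0 < blockLevel j := lt_of_lt_of_le (by omega) (mul_le_blockLevel j)
    rw [← Real.log_mul (by positivity) (by positivity), ← Real.log_mul (by positivity)
      (by positivity)]
    refine Real.log_le_log (by exact_mod_cast hpos) ?_
    exact_mod_cast blockLevel_le j
  have h2 : Real.log (l + 1) ≤ δ * (l + 1) - 1 - Real.log δ := by
    have := Real.log_le_sub_one_of_pos (show 0 < δ * ((l : ℝ) + 1) by positivity)
    rw [Real.log_mul hδ0.ne' (by positivity)] at this
    linarith
  have h3 : δ * l ≤ (1 - c) * Real.log j := by
    rw [hδ, mul_assoc, mul_comm (Real.log 2)]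
    exact mul_le_mul_of_nonneg_left hlj (by linarith)
  have h4 : c * Real.log (blockLevel j) ≤
      c * ((2 - c) * Real.log j + (Real.log 8 + δ - 1 - Real.log δ)) :=
    mul_le_mul_of_nonneg_left (by linarith) hc0
  -- The coefficient of $\log j$ is now $c(2-c)=1-(1-c)^2\le1$.
  have h5 : 0 ≤ (1 - c) ^ 2 * Real.log j := mul_nonneg (sq_nonneg _) (Real.log_nonneg hj')
  nlinarith

end Blocks

/-! ### Annuli, the Borel-Cantelli arguments and the conclusion -/

section Annuli

variable {L : ℕ} [NeZero L] {J : HierEdge L → ℝ≥0}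

variable (L) in
open scoped Classical in
/-- The annulus between two consecutive block levels. -/
noncomputable def hierAnnulus (j : ℕ) : Finset (HierLattice L) :=
  hierBall L (blockLevel (j + 1)) \ hierBall L (blockLevel j)

theorem mem_hierAnnulus {j : ℕ} {x : HierLattice L} : x ∈ hierAnnulus L j ↔
    x ∈ hierBall L (blockLevel (j + 1)) ∧ x ∉ hierBall L (blockLevel j) :=
  Finset.mem_sdiff

theorem coe_hierAnnulus (j : ℕ) : (hierAnnulus L j : Set (HierLattice L)) =
    (hierBall L (blockLevel (j + 1)) : Set (HierLattice L)) \ hierBall L (blockLevel j) :=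
  Set.ext fun _ => mem_hierAnnulus

theorem disjoint_hierAnnulus {i j : ℕ} (h : i < j) :
    Disjoint (hierAnnulus L i) (hierAnnulus L j) :=
  Finset.disjoint_left.2 fun _ hx hy => (mem_hierAnnulus.1 hy).2
    (hierBall_mono (blockLevel_strictMono.monotone h) (mem_hierAnnulus.1 hx).1)

theorem disjoint_joinPairs_hierAnnulus :
    Pairwise fun i j => Disjoint
      (joinPairs (hierAnnulus L (2 * i)) (hierAnnulus L (2 * i + 1)))
      (joinPairs (hierAnnulus L (2 * j)) (hierAnnulus L (2 * j + 1))) := by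
  have key : ∀ i j, i < j → Disjoint
      (joinPairs (hierAnnulus L (2 * i)) (hierAnnulus L (2 * i + 1)))
      (joinPairs (hierAnnulus L (2 * j)) (hierAnnulus L (2 * j + 1))) := by
    intro i j hij
    refine Finset.disjoint_left.2 fun e h1 h2 => ?_
    induction e using Sym2.ind with
    | _ x y =>
      rcases exists_mem_of_mem_joinPairs h1 with h1 | h1 <;>
      rcases exists_mem_of_mem_joinPairs h2 with h2 | h2 <;>
      exact Finset.disjoint_left.1 (disjoint_hierAnnulus (by omega)) h1 h2
  intro i j hij
  rcases lt_or_gt_of_ne hij with h | h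
  · exact key i j h
  · exact (key j i h).symm

theorem IsIsometryInvariant.sum_tsum_le (hJ : IsIsometryInvariant J) {A : Finset (HierLattice L)}
    {n : ℕ} {p : HierLattice L → Prop} [DecidablePred p] (hA : A ⊆ hierBall L n)
    (hp : ∀ x ∈ A, ∀ y, p y → n < hierLevel x y) :
    ∑ x ∈ A, ∑' y, (if p y then (pairWeight J x y : ℝ≥0∞) else 0) ≤
      (L : ℝ≥0∞) ^ n * tailWeight J n := by
  refine (Finset.sum_le_card_nsmul _ _ (tailWeight J n) fun x hx =>
    hJ.tsum_pairWeight_le (hp x hx)).trans ?_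
  rw [nsmul_eq_mul]
  gcongr
  have := Finset.card_le_card hA
  rw [card_hierBall] at this
  exact_mod_cast this

theorem IsIsometryInvariant.sum_sum_le (hJ : IsIsometryInvariant J)
    {A B : Finset (HierLattice L)} {n : ℕ} (hA : A ⊆ hierBall L n)
    (hB : ∀ y ∈ B, y ∉ hierBall L n) :
    ∑ x ∈ A, ∑ y ∈ B, (pairWeight J x y : ℝ≥0∞) ≤ (L : ℝ≥0∞) ^ n * tailWeight J n := by
  classical
  refine le_trans (Finset.sum_le_sum fun x _ => ?_)
    (hJ.sum_tsum_le (p := (· ∈ B)) hA fun x hx y hy => lt_hierLevel (hA hx) (hB y hy))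
  rw [← Finset.sum_congr rfl fun y hy => if_pos (c := y ∈ B) hy]
  exact ENNReal.sum_le_tsum B

/-- The number of points is that of the smaller ball while the tail starts at the larger level; this
gains the factor $L^{-(n_{j+1}-n_j)}$ over the boundary weight of the larger ball. -/
theorem percMeasure_skip_le (hJ : IsIsometryInvariant J) (j : ℕ) :
    percMeasure J {ω | ∃ x ∈ hierBall L (blockLevel j), ∃ y ∉ hierBall L (blockLevel (j + 1)),
      (openGraph ω).Adj x y} ≤ (L : ℝ≥0∞) ^ blockLevel j * tailWeight J (blockLevel (j + 1)) := by
  classical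
  refine (percMeasure_exists_adj_le _ _).trans ?_
  refine (Finset.sum_le_card_nsmul _ _ (tailWeight J (blockLevel (j + 1))) fun x hx =>
    hJ.tsum_pairWeight_le fun y hy => lt_hierLevel
      (hierBall_mono (blockLevel_strictMono (Nat.lt_succ_self j)).le hx) hy).trans (le_of_eq ?_)
  rw [card_hierBall, nsmul_eq_mul, Nat.cast_pow]

/-- Edges leaving the annulus cross one of its two bounding spheres, hence the sum of two boundary
weights. Every such edge has level above `blockLevel j`, which bounds the weight at a single point.
-/
theorem percMeasure_not_deadEnd_hierAnnulus_le (hJ : IsIsometryInvariant J) (M j : ℕ) :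
    percMeasure J {ω | ¬ SmallClustersDeadEnd (openGraph ω) (hierAnnulus L j) M} ≤
      ((L : ℝ≥0∞) ^ blockLevel j * tailWeight J (blockLevel j) +
        (L : ℝ≥0∞) ^ blockLevel (j + 1) * tailWeight J (blockLevel (j + 1))) *
      (tailWeight J (blockLevel j) * M) := by
  classical
  have hlt := blockLevel_strictMono (Nat.lt_succ_self j)
  have hlev : ∀ w ∈ hierAnnulus L j, ∀ u ∉ hierAnnulus L j,
      blockLevel j < hierLevel w u := by
    intro w hw u hu
    obtain ⟨hw1, hw2⟩ := mem_hierAnnulus.1 hw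
    by_cases hu1 : u ∈ hierBall L (blockLevel j)
    · rw [hierLevel_comm]
      exact lt_hierLevel hu1 hw2
    · exact hlt.trans (lt_hierLevel hw1 fun h => hu (mem_hierAnnulus.2 ⟨h, hu1⟩))
  refine (percMeasure_not_smallClustersDeadEnd_le (hierAnnulus L j) M
    fun w hw => hJ.tsum_pairWeight_le (hlev w hw)).trans ?_
  gcongr
  have hsplit : ∀ w ∈ hierAnnulus L j,
      ∑' u, (if u ∉ hierAnnulus L j then (pairWeight J w u : ℝ≥0∞) else 0) ≤
        ∑ u ∈ hierBall L (blockLevel j), (pairWeight J u w : ℝ≥0∞) +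
        ∑' u, (if u ∉ hierBall L (blockLevel (j + 1)) then (pairWeight J w u : ℝ≥0∞) else 0) := by
    intro w _
    have h1 : ∑ u ∈ hierBall L (blockLevel j), (pairWeight J u w : ℝ≥0∞) =
        ∑' u, if u ∈ hierBall L (blockLevel j) then (pairWeight J w u : ℝ≥0∞) else 0 := by
      rw [tsum_eq_sum fun u hu => if_neg hu]
      refine Finset.sum_congr rfl fun u hu => ?_
      rw [if_pos hu, pairWeight_comm]
    rw [h1, ← ENNReal.tsum_add]
    refine ENNReal.tsum_le_tsum fun u => ?_
    by_cases hu : u ∈ hierAnnulus L j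
    · rw [if_neg (not_not.2 hu)]
      exact zero_le
    · rw [if_pos hu]
      by_cases hu1 : u ∈ hierBall L (blockLevel j)
      · rw [if_pos hu1]
        exact le_self_add
      · rw [if_pos fun h => hu (mem_hierAnnulus.2 ⟨h, hu1⟩)]
        exact le_add_self
  refine (Finset.sum_le_sum hsplit).trans ?_
  rw [Finset.sum_add_distrib, Finset.sum_comm]
  refine add_le_add ?_ ?_
  · exact hJ.sum_sum_le subset_rfl fun y hy => (mem_hierAnnulus.1 hy).2
  · exact hJ.sum_tsum_le (fun x hx => (mem_hierAnnulus.1 hx).1)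
      fun x hx y hy => lt_hierLevel (mem_hierAnnulus.1 hx).1 hy

/-- Tailored to the exceptional events: the gain is $(j+1)^8$, while boundary weights are $O(j^2)$
and enter at most twice. -/
theorem tsum_ne_top_of_eventually_le {f : ℕ → ℝ≥0∞} (hf : ∀ j, f j ≠ ∞) {K : ℝ} (hK : 0 ≤ K)
    {j₀ : ℕ} (h : ∀ j, j₀ ≤ j → f j * ((j : ℝ≥0∞) + 1) ^ 8 ≤ ENNReal.ofReal (K * (j + 1) ^ 4)) :
    ∑' j, f j ≠ ∞ := by
  have hle : ∀ j, f (j + j₀) ≤ ENNReal.ofReal (K * (1 / ((j : ℝ) + 1) ^ 2)) := by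
    intro j
    have h1 := h (j + j₀) (by omega)
    have hc : ((((j + j₀ : ℕ) : ℝ≥0∞)) + 1) ^ 8 =
        ENNReal.ofReal (((((j + j₀ : ℕ) : ℝ)) + 1) ^ 8) := by
      rw [ENNReal.ofReal_pow (by positivity), ENNReal.ofReal_add (by positivity) zero_le_one,
        ENNReal.ofReal_natCast, ENNReal.ofReal_one]
    have hpos : 0 < ((((j + j₀ : ℕ) : ℝ)) + 1) ^ 8 := by positivity
    rw [hc, ← ENNReal.le_div_iff_mul_le (Or.inl (by simpa using hpos))
      (Or.inl ENNReal.ofReal_ne_top), ← ENNReal.ofReal_div_of_pos hpos] at h1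
    refine h1.trans (ENNReal.ofReal_le_ofReal ?_)
    have hx : (1 : ℝ) ≤ ((j + j₀ : ℕ) : ℝ) + 1 := by
      have : (0 : ℝ) ≤ ((j + j₀ : ℕ) : ℝ) := Nat.cast_nonneg _
      linarith
    have hjx : ((j : ℝ) + 1) ≤ ((j + j₀ : ℕ) : ℝ) + 1 := by
      push_cast
      have : (0 : ℝ) ≤ (j₀ : ℝ) := Nat.cast_nonneg _
      linarith
    set x : ℝ := ((j + j₀ : ℕ) : ℝ) + 1
    calc K * x ^ 4 / x ^ 8 = K * (1 / x ^ 4) := by field_simp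
      _ ≤ K * (1 / ((j : ℝ) + 1) ^ 2) := by
        gcongr
        calc ((j : ℝ) + 1) ^ 2 ≤ x ^ 2 := by gcongr
          _ ≤ x ^ 4 := pow_le_pow_right₀ hx (by norm_num)
  have hsum : Summable fun j : ℕ => K * (1 / ((j : ℝ) + 1) ^ 2) := by
    refine Summable.mul_left K ?_
    have := (summable_nat_add_iff 1).2 (Real.summable_one_div_nat_pow.2 one_lt_two)
    simpa using this
  rw [← ENNReal.summable.sum_add_tsum_nat_add' (k := j₀)]
  refine ENNReal.add_ne_top.2 ⟨ENNReal.sum_ne_top.2 fun i _ => hf i, ?_⟩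
  refine ne_top_of_le_ne_top ?_ (ENNReal.tsum_le_tsum hle)
  rw [← ENNReal.ofReal_tsum_of_nonneg (fun j => by positivity) hsum]
  exact ENNReal.ofReal_ne_top

theorem tsum_eq_top_of_harmonic_le {f : ℕ → ℝ≥0∞} {k : ℝ} (hk : 0 < k) {i₀ : ℕ}
    (h : ∀ i, i₀ ≤ i → ENNReal.ofReal (k / (2 * i + 1)) ≤ f i) : ∑' i, f i = ∞ := by
  by_contra htop
  have hle : ∑' i, ENNReal.ofReal (k / (2 * ((i + i₀ : ℕ) : ℝ) + 1)) ≤ ∑' i, f i :=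
    (ENNReal.tsum_le_tsum fun i => h (i + i₀) (by omega)).trans
      (ENNReal.tsum_comp_le_tsum_of_injective (add_left_injective i₀) f)
  have hs : Summable fun i : ℕ => k / (2 * ((i + i₀ : ℕ) : ℝ) + 1) := by
    have := ENNReal.summable_toReal (ne_top_of_le_ne_top htop hle)
    refine this.congr fun i => ?_
    rw [ENNReal.toReal_ofReal (by positivity)]
  have hs1 : Summable fun i : ℕ => k / (2 * (i : ℝ) + 1) :=
    (summable_nat_add_iff (f := fun i : ℕ => k / (2 * (i : ℝ) + 1)) i₀).1 hs
  have hs2 : Summable fun i : ℕ => (1 : ℝ) / ((i + 1 : ℕ) : ℝ) := by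
    refine Summable.of_nonneg_of_le (fun i => by positivity) (fun i => ?_) (hs1.mul_left (2 / k))
    push_cast
    rw [div_mul_div_comm, mul_comm k, mul_div_mul_right _ _ hk.ne', div_le_div_iff₀ (by positivity)
      (by positivity)]
    linarith
  exact Real.not_summable_one_div_natCast
    ((summable_nat_add_iff (f := fun i : ℕ => (1 : ℝ) / (i : ℝ)) 1).1 hs2)

/-- If `β < b` and `b * θ ^ 2 < 1`, then almost surely the cluster of the origin is finite. -/
theorem clusterDensity_eq_zero_of_kernelLimsup_lt (hJ : IsIsometryInvariant J) (hL : 2 ≤ L)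
    {b : ℝ} (hb0 : 0 ≤ b) (hb : kernelLimsup J < (b : EReal))
    (hbθ : b * clusterDensity J ^ 2 < 1) : clusterDensity J = 0 := by
  classical
  set μ := percMeasure J with hμ
  obtain ⟨C, hC0, n₀, hW⟩ := hJ.exists_tailWeight_le hL hb0 hb
  -- For the summable events a bound linear in `n` suffices; the sharp logarithm is needed only for
  -- `hgood`.
  have hWlin : ∀ n, n₀ ≤ n → 1 ≤ n →
      (L : ℝ≥0∞) ^ n * tailWeight J n ≤ ENNReal.ofReal ((b + C) * n) := by
    intro n hn hn1
    refine (hW n hn hn1).trans (ENNReal.ofReal_le_ofReal ?_)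
    have h1 : (1 : ℝ) ≤ n := by exact_mod_cast hn1
    have h2 := Real.log_le_sub_one_of_pos (show (0 : ℝ) < n by linarith)
    nlinarith [mul_le_mul_of_nonneg_left h2 hb0]
  have hlevel : ∀ j, n₀ + 1 ≤ j → n₀ ≤ blockLevel j ∧ 1 ≤ blockLevel j := fun j hj => by
    have := mul_le_blockLevel j
    omega
  have hWblock : ∀ i j : ℕ, n₀ + 1 ≤ i → i ≤ j →
      (L : ℝ≥0∞) ^ blockLevel i * tailWeight J (blockLevel i) ≤
        ENNReal.ofReal (8 * (b + C) * (j : ℝ) ^ 2) := by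
    intro i j hi hij
    refine (hWlin _ (hlevel i hi).1 (hlevel i hi).2).trans (ENNReal.ofReal_le_ofReal ?_)
    have h1 : (blockLevel i : ℝ) ≤ 8 * (j : ℝ) ^ 2 := by
      exact_mod_cast (blockLevel_le_sq i).trans (by gcongr)
    nlinarith [mul_le_mul_of_nonneg_left h1 (add_nonneg hb0 hC0)]
  -- The strict inequality for `θ` passes to the approximations that decrease to it; `M` stays fixed
  -- from here on.
  obtain ⟨M, hM⟩ : ∃ M, b * μ.real (largeCluster M 0) ^ 2 < 1 :=
    (((tendsto_largeCluster (J := J)).pow 2).const_mul b |>.eventually_lt_const hbθ).exists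
  let skip : ℕ → Set (HierEdge L → Bool) := fun j =>
    {ω | ∃ x ∈ hierBall L (blockLevel j), ∃ y ∉ hierBall L (blockLevel (j + 1)),
      (openGraph ω).Adj x y}
  let bad : ℕ → Set (HierEdge L → Bool) := fun j =>
    {ω | ¬ SmallClustersDeadEnd (openGraph ω) (hierAnnulus L j) M}
  let good : ℕ → Set (HierEdge L → Bool) := fun j =>
    {ω | ¬ LargeClustersJoined (openGraph ω) (hierAnnulus L j) (hierAnnulus L (j + 1)) M}
  have hskip : ∑' j, μ (skip j) ≠ ∞ := by
    refine tsum_ne_top_of_eventually_le (fun j => measure_ne_top _ _) (K := 8 * (b + C))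
      (by positivity) (j₀ := n₀ + 1) fun j hj => ?_
    have h1 : ((j : ℝ≥0∞) + 1) ^ 8 ≤ (L : ℝ≥0∞) ^ (8 * (Nat.log 2 (j + 1) + 1)) := by
      exact_mod_cast pow_le_pow_blockLevel_sub hL j
    calc μ (skip j) * ((j : ℝ≥0∞) + 1) ^ 8
        ≤ ((L : ℝ≥0∞) ^ blockLevel j * tailWeight J (blockLevel (j + 1))) *
          (L : ℝ≥0∞) ^ (8 * (Nat.log 2 (j + 1) + 1)) := mul_le_mul' (percMeasure_skip_le hJ j) h1
      _ = (L : ℝ≥0∞) ^ blockLevel (j + 1) * tailWeight J (blockLevel (j + 1)) := by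
        rw [blockLevel_succ, pow_add]
        ring
      _ ≤ ENNReal.ofReal (8 * (b + C) * ((j + 1 : ℕ) : ℝ) ^ 2) :=
        hWblock (j + 1) (j + 1) (by omega) le_rfl
      _ ≤ ENNReal.ofReal (8 * (b + C) * ((j : ℝ) + 1) ^ 4) := by
        apply ENNReal.ofReal_le_ofReal
        push_cast
        have : (1 : ℝ) ≤ (j : ℝ) + 1 := by linarith [(Nat.cast_nonneg j : (0 : ℝ) ≤ j)]
        gcongr
        norm_num
  have hbad : ∑' j, μ (bad j) ≠ ∞ := by
    refine tsum_ne_top_of_eventually_le (fun j => measure_ne_top _ _)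
      (K := 2 * (8 * (b + C)) * (8 * (b + C)) * M) (by positivity) (j₀ := n₀ + 1) fun j hj => ?_
    have h1 : ((j : ℝ≥0∞) + 1) ^ 8 ≤ (L : ℝ≥0∞) ^ blockLevel j := by
      exact_mod_cast pow_le_pow_blockLevel hL j
    have h2 := hWblock j (j + 1) hj (by omega)
    have h3 := hWblock (j + 1) (j + 1) (by omega) le_rfl
    set w := ENNReal.ofReal (8 * (b + C) * ((j + 1 : ℕ) : ℝ) ^ 2) with hw
    calc μ (bad j) * ((j : ℝ≥0∞) + 1) ^ 8
        ≤ (((L : ℝ≥0∞) ^ blockLevel j * tailWeight J (blockLevel j) +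
          (L : ℝ≥0∞) ^ blockLevel (j + 1) * tailWeight J (blockLevel (j + 1))) *
          (tailWeight J (blockLevel j) * M)) * (L : ℝ≥0∞) ^ blockLevel j :=
          mul_le_mul' (percMeasure_not_deadEnd_hierAnnulus_le hJ M j) h1
      _ = ((L : ℝ≥0∞) ^ blockLevel j * tailWeight J (blockLevel j) +
          (L : ℝ≥0∞) ^ blockLevel (j + 1) * tailWeight J (blockLevel (j + 1))) *
          (((L : ℝ≥0∞) ^ blockLevel j * tailWeight J (blockLevel j)) * M) := by ring
      _ ≤ (w + w) * (w * M) := by gcongr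
      _ = ENNReal.ofReal (2 * (8 * (b + C)) * (8 * (b + C)) * M * ((j : ℝ) + 1) ^ 4) := by
        have hw0 : 0 ≤ 8 * (b + C) * ((j + 1 : ℕ) : ℝ) ^ 2 := by positivity
        rw [hw, ← ENNReal.ofReal_add hw0 hw0, ← ENNReal.ofReal_natCast M,
          ← ENNReal.ofReal_mul hw0, ← ENNReal.ofReal_mul (by positivity)]
        congr 1
        push_cast
        ring
  -- Only even indices are used, so that the pairs of annuli are disjoint and the events
  -- independent.
  have hgood : ∑' i, μ (good (2 * i)) = ∞ := by
    set θ := μ.real (largeCluster M 0) with hθ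
    obtain ⟨C', hC'⟩ := exists_mul_log_blockLevel_le (mul_nonneg hb0 (sq_nonneg θ)) hM
    refine tsum_eq_top_of_harmonic_le (Real.exp_pos (-(C' + θ ^ 2 * C))) (i₀ := n₀)
      fun i hi => ?_
    have hlev := hlevel (2 * i + 1) (by omega)
    have hsum : ∑ x ∈ hierAnnulus L (2 * i), ∑ y ∈ hierAnnulus L (2 * i + 1),
        (pairWeight J x y : ℝ) ≤ b * Real.log (blockLevel (2 * i + 1)) + C := by
      have h1 := (hJ.sum_sum_le (A := hierAnnulus L (2 * i)) (B := hierAnnulus L (2 * i + 1))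
        (n := blockLevel (2 * i + 1)) (fun x hx => (mem_hierAnnulus.1 hx).1)
        fun y hy => (mem_hierAnnulus.1 hy).2).trans (hW _ hlev.1 hlev.2)
      have h2 : 0 ≤ b * Real.log (blockLevel (2 * i + 1)) + C :=
        add_nonneg (mul_nonneg hb0 (Real.log_natCast_nonneg _)) hC0
      have h3 := ENNReal.toReal_mono ENNReal.ofReal_ne_top h1
      rw [ENNReal.toReal_ofReal h2] at h3
      refine le_trans (le_of_eq ?_) h3
      norm_cast
    have hjoin := exp_neg_le_measureReal_not_largeClustersJoined hJ
      (disjoint_hierAnnulus (L := L) (Nat.lt_succ_self (2 * i))) M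
      -- The logarithm is the main term $b\,\theta_M^2\log n_{2i+1}$ after the iterated logarithm
      -- has been absorbed; the exponential of `-a` is thus a constant over $2i+1$.
      (a := Real.log ((2 * i + 1 : ℕ) : ℝ) + (C' + θ ^ 2 * C)) (by
        have h1 := mul_le_mul_of_nonneg_left hsum (sq_nonneg θ)
        have h2 := hC' (2 * i + 1) (by omega)
        refine h1.trans ?_
        linarith)
    refine le_trans (ENNReal.ofReal_le_ofReal (le_trans (le_of_eq ?_) hjoin)) (le_of_eq ?_)
    · rw [neg_add (Real.log _), Real.exp_add, Real.exp_neg (Real.log _), Real.exp_log (by positivity)]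
      push_cast
      rw [div_eq_inv_mul]
    · exact ofReal_measureReal
  have hlimsup := ProbabilityTheory.measure_limsup_eq_one
    (fun i => (dependsOn_not_largeClustersJoined (hierAnnulus L (2 * i))
      (hierAnnulus L (2 * i + 1)) M).measurableSet)
    (iIndepSet_of_dependsOn _ (fun i => dependsOn_not_largeClustersJoined (hierAnnulus L (2 * i))
      (hierAnnulus L (2 * i + 1)) M)
      fun i j hij => disjoint_edgesOf (disjoint_joinPairs_hierAnnulus hij)) hgood
  have hfreq : ∀ᵐ ω ∂μ, ∃ᶠ i in atTop, ω ∈ good (2 * i) := by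
    have hmeas : MeasurableSet (limsup (fun i => good (2 * i)) atTop) :=
      MeasurableSet.measurableSet_limsup fun i => (dependsOn_not_largeClustersJoined
        (hierAnnulus L (2 * i)) (hierAnnulus L (2 * i + 1)) M).measurableSet
    filter_upwards [(prob_compl_eq_zero_iff hmeas).2 hlimsup] with ω hω
    exact mem_limsup_iff_frequently_mem.1 hω
  have hfin : ∀ᵐ ω ∂μ, ω ∉ {ω : HierEdge L → Bool | (openCluster ω 0).Infinite} := by
    filter_upwards [hfreq, ae_eventually_notMem hskip, ae_eventually_notMem hbad]
      with ω h1 h2 h3 hinf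
    obtain ⟨j₁, h2⟩ := eventually_atTop.1 h2
    obtain ⟨j₂, h3⟩ := eventually_atTop.1 h3
    obtain ⟨i, hi, hgi⟩ := (frequently_atTop.1 h1) (j₁ + j₂)
    obtain ⟨v, hv, hvC⟩ := hinf.exists_notMem_finset (hierBall L (blockLevel (2 * i + 1 + 1)))
    have hmono := blockLevel_strictMono.monotone
    refine hgi ?_
    have hd : ∀ j, j₂ ≤ j → SmallClustersDeadEnd (openGraph ω)
        ((hierBall L (blockLevel (j + 1)) : Set (HierLattice L)) \ hierBall L (blockLevel j)) M := by
      intro j hj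
      rw [← coe_hierAnnulus]
      exact not_not.1 (h3 j hj)
    have hs : ∀ j, j₁ ≤ j → ∀ x ∈ (hierBall L (blockLevel j) : Set (HierLattice L)),
        ∀ y ∉ (hierBall L (blockLevel (j + 1)) : Set (HierLattice L)),
          ¬ (openGraph ω).Adj x y :=
      fun j hj x hx y hy hadj => h2 j hj ⟨x, hx, y, hy, hadj⟩
    rw [coe_hierAnnulus, coe_hierAnnulus]
    exact largeClustersJoined_of_reachable
      (Finset.coe_subset.2 (hierBall_mono (hmono (by omega))))
      (Finset.coe_subset.2 (hierBall_mono (hmono (by omega))))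
      (zero_mem_hierBall _) hvC hv (hs _ (by omega)) (hs _ (by omega)) (hd _ (by omega))
      (hd _ (by omega))
  rw [clusterDensity, measureReal_def, measure_eq_zero_iff_ae_notMem.2 hfin, ENNReal.toReal_zero]

end Annuli

theorem proposition4p1 (L : ℕ) (hL : 2 ≤ L) (J : HierEdge L → ℝ≥0) (hJ : IsIsometryInvariant J) :
    clusterDensity J = 0 ∨ 1 ≤ kernelLimsup J * ((clusterDensity J : ℝ) : EReal) ^ 2 := by
  have : NeZero L := ⟨by omega⟩
  by_contra! h
  obtain ⟨hθ, hβ⟩ := h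
  refine hθ ?_
  have hθ2 : 0 < clusterDensity J ^ 2 := by positivity
  rw [← EReal.coe_pow] at hβ
  -- The maximum with 0 supplies a nonnegative `b`. The case of infinite limsup is covered as well,
  -- since it would already make the product at least 1.
  have hlt : max (kernelLimsup J) 0 < ((1 / clusterDensity J ^ 2 : ℝ) : EReal) := by
    refine max_lt ?_ (EReal.coe_pos.2 (by positivity))
    by_contra hle
    have h1 := mul_le_mul_of_nonneg_right (not_lt.1 hle) (EReal.coe_nonneg.2 hθ2.le)
    rw [← EReal.coe_mul, one_div_mul_cancel hθ2.ne', EReal.coe_one] at h1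
    exact absurd hβ (not_lt.2 h1)
  obtain ⟨b, hb1, hb2⟩ := EReal.lt_iff_exists_real_btwn.1 hlt
  refine clusterDensity_eq_zero_of_kernelLimsup_lt hJ hL (b := b) ?_
    ((le_max_left _ _).trans_lt hb1) ?_
  · exact (EReal.coe_pos.1 ((le_max_right _ _).trans_lt hb1)).le
  · rwa [EReal.coe_lt_coe_iff, lt_div_iff₀ hθ2] at hb2
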